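/- Let $\Bbbk$ be an algebraically closed field of characteristic zero, let $n \ge 0$ be an integer and let $p$ be an odd prime. Let $H$ be a Hopf algebra over $\Bbbk$ of dimension $2^n p$. If $H$ has a Hopf subalgebra of dimension $2^n$ that is semisimple (as an algebra), then $H$ is semisimple. -/

import Mathlib

open scoped TensorProduct

/-- A subalgebra `K` of a Hopf algebra `H` is a Hopf subalgebra if it is a subcoalgebra, that is,
`Δ(K) ⊆ K ⊗ K` inside `H ⊗ H`, and is stable under the antipode. -/
structure IsHopfSubalgebra {𝕜 H : Type*} [Field 𝕜] [Ring H] [HopfAlgebra 𝕜 H]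
    (K : Subalgebra 𝕜 H) : Prop where
  comul_mem : ∀ x ∈ K, (Coalgebra.comul x : H ⊗[𝕜] H) ∈
    LinearMap.range (TensorProduct.mapIncl (Subalgebra.toSubmodule K) (Subalgebra.toSubmodule K))
  antipode_mem : ∀ x ∈ K, HopfAlgebra.antipode 𝕜 x ∈ K

/-! Let e be the normalized integral of the semisimple Hopf subalgebra K, an idempotent with S²(e) =
e. The functional a ↦ Tr(x ↦ S²(x)a) is an integral in H*, and a nonzero integral gives a
nondegenerate form l(ab). This functional kills the Jacobson radical, so one nonzero value makes H
semisimple (`isSemisimpleRing_of_trace_ne_zero`). Its value at e is the trace of S² on the left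
ideal He, and the whole problem is to see that this trace is not zero. A dimension count in the
spirit of the Nichols–Zoeller theorem (`finrank_eq_finrank_range_mulRight_mul`) gives dim He = dim H
/ dim K = p.

Radford's formula (`exists_antipodeSq_antipodeSq_eq`) expresses S⁴ through conjugation by a
group-like g and the left and right translations by a character α. If g and the translation both
have 2-power order, so does S². An operator of 2-power order has eigenvalues congruent to 1 modulo a
prime above 2, so its trace on a space of odd dimension p is nonzero
(`dvd_finrank_of_trace_eq_zero`).

Otherwise some power of g or of the translation has odd prime order l. Such an order divides dim H =
2ⁿp, so l = p, and then S² is the identity on He, with trace p ≠ 0. For a group-like c of order p,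
the vectors cⁱe are a basis of He fixed by S². For a translation T of order p, the characters ε ∘ Tⁱ
restrict to a basis of the dual of He, and every character is S²-invariant. In both cases p ∤ dim K
keeps the p objects distinct on He or normalized at e. -/

namespace HopfAlgebra

open Coalgebra

/-! ### Sweedler identities for the comultiplication and the antipode -/

section Sweedler

variable {𝕜 H : Type*} [Field 𝕜] [Ring H] [HopfAlgebra 𝕜 H]

/-- Coassociativity, evaluated under a linear map. -/
lemma sum_coassoc {M : Type*} [AddCommGroup M] [Module 𝕜 M] (T : H ⊗[𝕜] (H ⊗[𝕜] H) →ₗ[𝕜] M)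
    (x : H) :
    ∑ i ∈ (ℛ 𝕜 x).index, ∑ j ∈ (ℛ 𝕜 ((ℛ 𝕜 x).left i)).index,
      T ((ℛ 𝕜 ((ℛ 𝕜 x).left i)).left j ⊗ₜ
        ((ℛ 𝕜 ((ℛ 𝕜 x).left i)).right j ⊗ₜ (ℛ 𝕜 x).right i)) =
    ∑ i ∈ (ℛ 𝕜 x).index, ∑ j ∈ (ℛ 𝕜 ((ℛ 𝕜 x).right i)).index,
      T ((ℛ 𝕜 x).left i ⊗ₜ ((ℛ 𝕜 ((ℛ 𝕜 x).right i)).left j ⊗ₜ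
        (ℛ 𝕜 ((ℛ 𝕜 x).right i)).right j)) := by
  have h := congrArg T (sum_tmul_tmul_eq (ℛ 𝕜 x) (fun i ↦ ℛ 𝕜 ((ℛ 𝕜 x).left i))
    (fun i ↦ ℛ 𝕜 ((ℛ 𝕜 x).right i)))
  simpa only [map_sum] using h

lemma comul_eq_sum (x : H) :
    comul (R := 𝕜) x = ∑ i ∈ (ℛ 𝕜 x).index, (ℛ 𝕜 x).left i ⊗ₜ[𝕜] (ℛ 𝕜 x).right i :=
  (ℛ 𝕜 x).eq.symm

lemma sum_smul_counit (x : H) :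
    ∑ i ∈ (ℛ 𝕜 x).index, counit (R := 𝕜) ((ℛ 𝕜 x).right i) • (ℛ 𝕜 x).left i = x := by
  have h := congrArg (TensorProduct.rid 𝕜 H) (sum_tmul_counit_eq (ℛ 𝕜 x))
  simpa only [map_sum, TensorProduct.rid_tmul, one_smul] using h

/-- `∑ Δ(x₁) (1 ⊗ S(x₂)) = x ⊗ 1`. -/
lemma sum_comul_mul_antipode (x : H) :
    ∑ i ∈ (ℛ 𝕜 x).index, comul (R := 𝕜) ((ℛ 𝕜 x).left i) *
      (1 ⊗ₜ[𝕜] antipode 𝕜 ((ℛ 𝕜 x).right i)) = x ⊗ₜ[𝕜] 1 := by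
  have h := sum_coassoc (𝕜 := 𝕜) (LinearMap.lTensor H (LinearMap.mul' 𝕜 H ∘ₗ
    (antipode 𝕜).lTensor H)) x
  simp only [LinearMap.lTensor_tmul, LinearMap.comp_apply, LinearMap.mul'_apply,
    ← TensorProduct.tmul_sum, sum_mul_antipode_eq_smul, TensorProduct.tmul_smul] at h
  rw [← sum_smul_counit (𝕜 := 𝕜) x, TensorProduct.sum_tmul]
  simp only [← TensorProduct.smul_tmul']
  rw [sum_smul_counit, ← h]
  refine Finset.sum_congr rfl fun i _ ↦ ?_
  rw [comul_eq_sum, Finset.sum_mul]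
  simp

/-- `∑ (S(x₁) ⊗ 1) Δ(x₂) = 1 ⊗ x`. -/
lemma sum_antipode_mul_comul (x : H) :
    ∑ i ∈ (ℛ 𝕜 x).index, (antipode 𝕜 ((ℛ 𝕜 x).left i) ⊗ₜ[𝕜] 1) *
      comul (R := 𝕜) ((ℛ 𝕜 x).right i) = 1 ⊗ₜ[𝕜] x := by
  have h := sum_coassoc (𝕜 := 𝕜) (LinearMap.rTensor H (LinearMap.mul' 𝕜 H ∘ₗ
    (antipode 𝕜).rTensor H) ∘ₗ (TensorProduct.assoc 𝕜 H H H).symm.toLinearMap) x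
  simp only [LinearMap.rTensor_tmul, LinearMap.comp_apply, LinearMap.mul'_apply,
    LinearEquiv.coe_coe, TensorProduct.assoc_symm_tmul,
    ← TensorProduct.sum_tmul, sum_antipode_mul_eq_smul, TensorProduct.smul_tmul] at h
  rw [← TensorProduct.tmul_sum, sum_counit_smul] at h
  rw [h]
  refine Finset.sum_congr rfl fun i _ ↦ ?_
  rw [comul_eq_sum, Finset.mul_sum]
  simp

/-- The antipode is an anticomorphism: `Δ(S x) = ∑ S(x₂) ⊗ S(x₁)`. -/
lemma comul_antipode (x : H) :
    comul (R := 𝕜) (antipode 𝕜 x) = TensorProduct.map (antipode 𝕜) (antipode 𝕜)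
      (TensorProduct.comm 𝕜 H H (comul x)) := by
  let F : H →ₗ[𝕜] H ⊗[𝕜] H := comul ∘ₗ antipode 𝕜
  let G : H →ₗ[𝕜] H ⊗[𝕜] H := TensorProduct.map (antipode 𝕜) (antipode 𝕜) ∘ₗ
    (TensorProduct.comm 𝕜 H H).toLinearMap ∘ₗ comul
  suffices h : WithConv.toConv G = WithConv.toConv F by
    exact (congrArg (fun f ↦ f.ofConv x) h).symm
  -- Both sides are convolution inverses of Δ in Hom(H, H ⊗ H): G on the left, F on the right.
  refine left_inv_eq_right_inv (a := WithConv.toConv (comul (R := 𝕜) (A := H))) ?_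
    LinearMap.comul_right_inv
  ext y
  rw [(ℛ 𝕜 y).convMul_apply]
  have h := sum_coassoc (𝕜 := 𝕜) (LinearMap.mul' 𝕜 (H ⊗[𝕜] H) ∘ₗ
    TensorProduct.map (TensorProduct.map (antipode 𝕜) (antipode 𝕜) ∘ₗ
      (TensorProduct.comm 𝕜 H H).toLinearMap) comul ∘ₗ
    (TensorProduct.assoc 𝕜 H H H).symm.toLinearMap) y
  simp only [LinearMap.comp_apply, LinearMap.mul'_apply, LinearEquiv.coe_coe,
    TensorProduct.assoc_symm_tmul, TensorProduct.map_tmul, TensorProduct.comm_tmul] at h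
  have hG (z : H) : G z = ∑ j ∈ (ℛ 𝕜 z).index,
      antipode 𝕜 ((ℛ 𝕜 z).right j) ⊗ₜ[𝕜] antipode 𝕜 ((ℛ 𝕜 z).left j) := by
    simp only [G, LinearMap.comp_apply, LinearEquiv.coe_coe]
    rw [comul_eq_sum]
    simp
  simp only [hG, Finset.sum_mul]
  rw [h]
  have h2 (i) : ∑ j ∈ (ℛ 𝕜 ((ℛ 𝕜 y).right i)).index,
      (antipode 𝕜 ((ℛ 𝕜 ((ℛ 𝕜 y).right i)).left j) ⊗ₜ[𝕜] antipode 𝕜 ((ℛ 𝕜 y).left i)) *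
        comul (R := 𝕜) ((ℛ 𝕜 ((ℛ 𝕜 y).right i)).right j) =
      1 ⊗ₜ[𝕜] (antipode 𝕜 ((ℛ 𝕜 y).left i) * (ℛ 𝕜 y).right i) := by
    have := congrArg (fun t ↦ (1 ⊗ₜ[𝕜] antipode 𝕜 ((ℛ 𝕜 y).left i)) * t)
      (sum_antipode_mul_comul (𝕜 := 𝕜) ((ℛ 𝕜 y).right i))
    simpa [Finset.mul_sum, ← mul_assoc] using this
  simp only [h2, ← TensorProduct.tmul_sum, sum_antipode_mul_eq_smul]
  simp [Algebra.algebraMap_eq_smul_one, Algebra.TensorProduct.one_def]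

variable (𝕜 H) in
/-- The square of the antipode, as an algebra endomorphism. -/
noncomputable def antipodeSq : H →ₐ[𝕜] H :=
  AlgHom.ofLinearMap (antipode 𝕜 ∘ₗ antipode 𝕜) (by simp)
    (fun x y ↦ by simp [antipode_mul_antidistrib])

lemma antipodeSq_apply (x : H) : antipodeSq 𝕜 H x = antipode 𝕜 (antipode 𝕜 x) := rfl

lemma comul_antipodeSq (x : H) :
    comul (R := 𝕜) (antipodeSq 𝕜 H x) = TensorProduct.map (antipodeSq 𝕜 H).toLinearMap
      (antipodeSq 𝕜 H).toLinearMap (comul (R := 𝕜) x) := by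
  rw [antipodeSq_apply, comul_antipode, comul_antipode]
  rw [comul_eq_sum x]
  simp [antipodeSq_apply]

/-- `∑ (1 ⊗ S(x₂)) Δ(S²(x₁)) = S²(x) ⊗ 1`. -/
lemma sum_antipode_mul_comul_antipodeSq (x : H) :
    ∑ i ∈ (ℛ 𝕜 x).index, (1 ⊗ₜ[𝕜] antipode 𝕜 ((ℛ 𝕜 x).right i)) *
      comul (R := 𝕜) (antipodeSq 𝕜 H ((ℛ 𝕜 x).left i)) = antipodeSq 𝕜 H x ⊗ₜ[𝕜] 1 := by
  have h := sum_coassoc (𝕜 := 𝕜) (TensorProduct.map (antipodeSq 𝕜 H).toLinearMap (antipode 𝕜 ∘ₗ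
    LinearMap.mul' 𝕜 H ∘ₗ (antipode 𝕜).rTensor H)) x
  simp only [TensorProduct.map_tmul, LinearMap.comp_apply, LinearMap.mul'_apply,
    LinearMap.rTensor_tmul, ← TensorProduct.tmul_sum, ← map_sum, sum_antipode_mul_eq_smul] at h
  have h3 (i) : (1 ⊗ₜ[𝕜] antipode 𝕜 ((ℛ 𝕜 x).right i)) *
      comul (R := 𝕜) (antipodeSq 𝕜 H ((ℛ 𝕜 x).left i)) =
      ∑ j ∈ (ℛ 𝕜 ((ℛ 𝕜 x).left i)).index,
        antipodeSq 𝕜 H ((ℛ 𝕜 ((ℛ 𝕜 x).left i)).left j) ⊗ₜ[𝕜]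
        antipode 𝕜 (antipode 𝕜 ((ℛ 𝕜 ((ℛ 𝕜 x).left i)).right j) * (ℛ 𝕜 x).right i) := by
    rw [comul_antipodeSq, comul_eq_sum, map_sum, Finset.mul_sum]
    simp [antipode_mul_antidistrib, antipodeSq_apply]
  simp only [AlgHom.toLinearMap_apply] at h
  simp only [h3, h, map_smul, antipode_one, TensorProduct.tmul_smul]
  simp only [TensorProduct.smul_tmul', ← map_smul, ← TensorProduct.sum_tmul, ← map_sum,
    sum_smul_counit]

end Sweedler
end HopfAlgebra

namespace HopfAlgebra

open Coalgebra

/-! ### Integrals on H obtained from traces -/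

section Integrals

variable {𝕜 H : Type*} [Field 𝕜] [Ring H] [HopfAlgebra 𝕜 H]

/-- The left hit action `a ↦ f(a₁) a₂` of a functional on a coalgebra. -/
noncomputable def hitLeft (f : H →ₗ[𝕜] 𝕜) : H →ₗ[𝕜] H :=
  (TensorProduct.lid 𝕜 H).toLinearMap ∘ₗ f.rTensor H ∘ₗ comul

/-- The right hit action `a ↦ a₁ f(a₂)` of a functional on a coalgebra. -/
noncomputable def hitRight (f : H →ₗ[𝕜] 𝕜) : H →ₗ[𝕜] H :=
  (TensorProduct.rid 𝕜 H).toLinearMap ∘ₗ f.lTensor H ∘ₗ comul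

lemma hitLeft_apply (f : H →ₗ[𝕜] 𝕜) (x : H) :
    hitLeft f x = ∑ i ∈ (ℛ 𝕜 x).index, f ((ℛ 𝕜 x).left i) • (ℛ 𝕜 x).right i := by
  simp only [hitLeft, LinearMap.comp_apply]
  rw [comul_eq_sum]
  simp

lemma hitRight_apply (f : H →ₗ[𝕜] 𝕜) (x : H) :
    hitRight f x = ∑ i ∈ (ℛ 𝕜 x).index, f ((ℛ 𝕜 x).right i) • (ℛ 𝕜 x).left i := by
  simp only [hitRight, LinearMap.comp_apply]
  rw [comul_eq_sum]
  simp

lemma hitLeft_counit (x : H) : hitLeft (counit (R := 𝕜)) x = x := by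
  rw [hitLeft_apply, sum_counit_smul]

lemma hitRight_counit (x : H) : hitRight (counit (R := 𝕜)) x = x := by
  rw [hitRight_apply, sum_smul_counit]

lemma apply_hitLeft_comm (f g : H →ₗ[𝕜] 𝕜) (x : H) : g (hitLeft f x) = f (hitRight g x) := by
  simp [hitLeft_apply, hitRight_apply, mul_comm]

/-- Pure coassociativity: both sides send x to f(x₁) x₂ ⊗ x₃. It makes left hits admissible as the
`M` of `traceForm`. -/
lemma comul_hitLeft (f : H →ₗ[𝕜] 𝕜) :
    comul ∘ₗ hitLeft f = (hitLeft f).rTensor H ∘ₗ comul (R := 𝕜) := by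
  ext x
  have h := sum_coassoc (𝕜 := 𝕜)
    ((TensorProduct.lid 𝕜 (H ⊗[𝕜] H)).toLinearMap ∘ₗ f.rTensor (H ⊗[𝕜] H)) x
  simp only [LinearMap.comp_apply, LinearMap.rTensor_tmul, LinearEquiv.coe_coe,
    TensorProduct.lid_tmul, ← Finset.smul_sum, ← comul_eq_sum] at h
  simp only [LinearMap.comp_apply, hitLeft_apply, map_sum, map_smul]
  rw [← h, comul_eq_sum x, map_sum]
  simp [hitLeft_apply, TensorProduct.sum_tmul, TensorProduct.smul_tmul']

/-- The functional `a ↦ Tr(x ↦ S²(M x) a)`. -/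
noncomputable def traceForm (M : H →ₗ[𝕜] H) : H →ₗ[𝕜] 𝕜 where
  toFun a := LinearMap.trace 𝕜 H (LinearMap.mulRight 𝕜 a ∘ₗ (antipodeSq 𝕜 H).toLinearMap ∘ₗ M)
  map_add' a b := by
    rw [← map_add]; congr 1; ext; simp [mul_add]
  map_smul' c a := by
    rw [RingHom.id_apply, ← map_smul]; congr 1; ext; simp

/-- A functional `l` with `l(a₁) a₂ = l(a) 1`. -/
def IsCointegral (l : H →ₗ[𝕜] 𝕜) : Prop :=
  ∀ a, hitLeft l a = l a • (1 : H)

/-- If `M` is a comodule endomorphism then `a ↦ Tr(x ↦ S²(M x) a)` is an integral on `H`. -/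
lemma isCointegral_traceForm [FiniteDimensional 𝕜 H] (M : H →ₗ[𝕜] H)
    (hM : comul ∘ₗ M = M.rTensor H ∘ₗ comul (R := 𝕜)) : IsCointegral (traceForm M) := by
  intro a
  rw [← sub_eq_zero, ← Module.forall_dual_apply_eq_zero_iff 𝕜]
  intro q
  rw [map_sub, sub_eq_zero, apply_hitLeft_comm, map_smul]
  let b := Module.finBasis 𝕜 H
  let E : H ⊗[𝕜] H →ₗ[𝕜] H := (TensorProduct.rid 𝕜 H).toLinearMap ∘ₗ q.lTensor H
  have hE (u : H) (t : H ⊗[𝕜] H) : E ((u ⊗ₜ 1) * t) = u * E t := by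
    induction t with
    | zero => simp
    | tmul x y => simp [E]
    | add x y hx hy => simp only [mul_add, map_add, hx, hy]
  -- In Sweedler notation B i y = y₁ q(S(bᵢ) y₂) and C i z = bᵢ*(z₂) S²(z₁)a. The sum of the B i ∘ C
  -- i is the operator for a₁q(a₂), while the sum of the C i ∘ M ∘ B i collapses to q(1) θ;
  -- cyclicity of the trace equates the two.
  let B (i) : H →ₗ[𝕜] H :=
    E ∘ₗ LinearMap.mulLeft 𝕜 (1 ⊗ₜ[𝕜] antipode 𝕜 (b i)) ∘ₗ comul
  let C (i) : H →ₗ[𝕜] H := (TensorProduct.rid 𝕜 H).toLinearMap ∘ₗ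
    TensorProduct.map (LinearMap.mulRight 𝕜 a ∘ₗ (antipodeSq 𝕜 H).toLinearMap) (b.coord i) ∘ₗ comul
  let θ : H →ₗ[𝕜] H := LinearMap.mulRight 𝕜 a ∘ₗ (antipodeSq 𝕜 H).toLinearMap ∘ₗ M
  have hb (w : H) : ∑ i, b.coord i w • b i = w := b.sum_repr w
  have h1 : LinearMap.mulRight 𝕜 (hitRight q a) ∘ₗ (antipodeSq 𝕜 H).toLinearMap =
      ∑ i, B i ∘ₗ C i := by
    ext z
    have hC (i) : C i z = ∑ j ∈ (ℛ 𝕜 z).index,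
        b.coord i ((ℛ 𝕜 z).right j) • (antipodeSq 𝕜 H ((ℛ 𝕜 z).left j) * a) := by
      simp only [C, LinearMap.comp_apply]
      rw [comul_eq_sum]
      simp
    have hB (w y : H) : ∑ i, b.coord i w • B i y =
        E ((1 ⊗ₜ[𝕜] antipode 𝕜 w) * comul (R := 𝕜) y) := by
      conv_rhs => rw [← hb w]
      simp only [map_sum, map_smul, TensorProduct.tmul_sum, TensorProduct.tmul_smul,
        Finset.sum_mul, smul_mul_assoc]
      rfl
    simp only [LinearMap.sum_apply, LinearMap.comp_apply, hC, map_sum, map_smul]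
    rw [Finset.sum_comm]
    simp only [hB, Bialgebra.comul_mul, ← mul_assoc]
    rw [← map_sum, ← Finset.sum_mul, sum_antipode_mul_comul_antipodeSq, hE]
    rfl
  have h2 : ∑ i, C i ∘ₗ M ∘ₗ B i = q 1 • θ := by
    ext y
    have hCM (i) (z : H) : C i (M z) = (TensorProduct.rid 𝕜 H)
        (TensorProduct.map θ (b.coord i) (comul z)) := by
      have := LinearMap.congr_fun hM z
      simp only [LinearMap.comp_apply] at this
      simp only [C, LinearMap.comp_apply, this, LinearMap.rTensor]
      simp [TensorProduct.map_map, θ, LinearMap.comp_assoc]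
    have hB (i) : B i y = ∑ j ∈ (ℛ 𝕜 y).index,
        q (antipode 𝕜 (b i) * (ℛ 𝕜 y).right j) • (ℛ 𝕜 y).left j := by
      simp only [B, LinearMap.comp_apply]
      rw [comul_eq_sum]
      simp [E]
    have hsum (w z : H) : ∑ i, b.coord i w * q (antipode 𝕜 (b i) * z) =
        q (antipode 𝕜 w * z) := by
      conv_rhs => rw [← hb w]
      simp only [map_sum, map_smul, Finset.sum_mul, smul_mul_assoc, smul_eq_mul]
    have h := sum_coassoc (𝕜 := 𝕜) ((TensorProduct.rid 𝕜 H).toLinearMap ∘ₗ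
      TensorProduct.map θ (q ∘ₗ LinearMap.mul' 𝕜 H ∘ₗ (antipode 𝕜).rTensor H)) y
    simp only [LinearMap.comp_apply, TensorProduct.map_tmul, LinearEquiv.coe_coe,
      TensorProduct.rid_tmul, LinearMap.rTensor_tmul, LinearMap.mul'_apply,
      ← Finset.sum_smul, ← map_sum, sum_antipode_mul_eq_smul] at h
    simp only [LinearMap.sum_apply, LinearMap.comp_apply, hB, map_sum, map_smul, hCM]
    rw [Finset.sum_comm]
    have h3 (j) : ∑ i, q (antipode 𝕜 (b i) * (ℛ 𝕜 y).right j) • (TensorProduct.rid 𝕜 H)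
        (TensorProduct.map θ (b.coord i) (comul ((ℛ 𝕜 y).left j))) =
        ∑ l ∈ (ℛ 𝕜 ((ℛ 𝕜 y).left j)).index,
          q (antipode 𝕜 ((ℛ 𝕜 ((ℛ 𝕜 y).left j)).right l) * (ℛ 𝕜 y).right j) •
            θ ((ℛ 𝕜 ((ℛ 𝕜 y).left j)).left l) := by
      rw [comul_eq_sum]
      simp only [map_sum, TensorProduct.map_tmul, TensorProduct.rid_tmul, Finset.smul_sum, smul_smul]
      rw [Finset.sum_comm]
      refine Finset.sum_congr rfl fun l _ ↦ ?_
      rw [← hsum, Finset.sum_smul]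
      exact Finset.sum_congr rfl fun i _ ↦ by rw [mul_comm]
    simp only [h3, h, map_smul, smul_eq_mul, LinearMap.smul_apply]
    conv_rhs => rw [← sum_smul_counit (𝕜 := 𝕜) y]
    simp only [map_sum, map_smul, Finset.smul_sum, smul_smul, mul_comm]
  calc traceForm M (hitRight q a)
      = LinearMap.trace 𝕜 H ((∑ i, B i ∘ₗ C i) ∘ₗ M) := by rw [← h1]; rfl
    _ = ∑ i, LinearMap.trace 𝕜 H ((B i ∘ₗ C i) ∘ₗ M) := by rw [← map_sum]; congr 1; ext; simp
    _ = ∑ i, LinearMap.trace 𝕜 H (C i ∘ₗ M ∘ₗ B i) := by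
        refine Finset.sum_congr rfl fun i _ ↦ ?_
        rw [LinearMap.comp_assoc, LinearMap.trace_comp_comm', LinearMap.comp_assoc]
    _ = q 1 * traceForm M a := by rw [← map_sum, h2, map_smul]; rfl
    _ = traceForm M a • q 1 := by rw [smul_eq_mul, mul_comm]

/-- The identity S²(x₃) S(x₂) x₁ = x writes id as a sum of operators whose traces are values of
integrals. If every integral vanished, Tr(id) = dim H would be zero, impossible in characteristic
zero. -/
lemma exists_isCointegral_ne_zero [CharZero 𝕜] [FiniteDimensional 𝕜 H] :
    ∃ l : H →ₗ[𝕜] 𝕜, IsCointegral l ∧ l ≠ 0 := by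
  by_contra! hcon
  let b := Module.finBasis 𝕜 H
  let G : H →ₗ[𝕜] H := LinearMap.mul' 𝕜 H ∘ₗ (antipode 𝕜).rTensor H ∘ₗ
    (TensorProduct.comm 𝕜 H H).toLinearMap ∘ₗ comul
  have hG (x : H) : G x = ∑ i ∈ (ℛ 𝕜 x).index,
      antipode 𝕜 ((ℛ 𝕜 x).right i) * (ℛ 𝕜 x).left i := by
    simp only [G, LinearMap.comp_apply]
    rw [comul_eq_sum]
    simp
  have h1 : ∑ j, LinearMap.mulRight 𝕜 (b j) ∘ₗ (antipodeSq 𝕜 H).toLinearMap ∘ₗ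
      hitLeft (b.coord j ∘ₗ G) = LinearMap.id := by
    ext x
    have h := sum_coassoc (𝕜 := 𝕜) (LinearMap.mul' 𝕜 H ∘ₗ (TensorProduct.comm 𝕜 H H).toLinearMap ∘ₗ
      TensorProduct.map LinearMap.id (LinearMap.mul' 𝕜 H ∘ₗ
        TensorProduct.map (antipodeSq 𝕜 H).toLinearMap (antipode 𝕜) ∘ₗ
        (TensorProduct.comm 𝕜 H H).toLinearMap)) x
    simp only [LinearMap.comp_apply, TensorProduct.map_tmul, LinearEquiv.coe_coe,
      TensorProduct.comm_tmul, LinearMap.mul'_apply, LinearMap.id_apply,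
      AlgHom.toLinearMap_apply, antipodeSq_apply, ← antipode_mul_antidistrib,
      ← Finset.sum_mul, ← map_sum, sum_mul_antipode_eq_smul] at h
    simp only [LinearMap.sum_apply, LinearMap.comp_apply, hitLeft_apply, map_sum, map_smul]
    rw [Finset.sum_comm]
    have hb (w z : H) : ∑ j, b.coord j w • LinearMap.mulRight 𝕜 (b j) z = z * w := by
      conv_rhs => rw [← b.sum_repr w]
      simp only [Finset.mul_sum, mul_smul_comm]
      rfl
    simp only [hb, hG, Finset.mul_sum, AlgHom.toLinearMap_apply, antipodeSq_apply, ← mul_assoc,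
      ← antipode_mul_antidistrib]
    rw [h]
    simp only [map_smul, antipode_one, smul_mul_assoc, one_mul, sum_smul_counit,
      LinearMap.id_apply]
  have h2 : LinearMap.trace 𝕜 H LinearMap.id = 0 := by
    rw [← h1, map_sum]
    refine Finset.sum_eq_zero fun j _ ↦ ?_
    exact LinearMap.congr_fun (hcon _ (isCointegral_traceForm _ (comul_hitLeft _))) (b j)
  rw [LinearMap.trace_id, Nat.cast_eq_zero] at h2
  have : Nontrivial H := Bialgebra.nontrivial (R := 𝕜)
  exact Module.finrank_pos.ne' h2

end Integrals
end HopfAlgebra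

namespace HopfAlgebra

open Coalgebra

/-! ### The Frobenius form of an integral and the trace criterion for semisimplicity -/

section Nondegenerate

variable {𝕜 H : Type*} [Field 𝕜] [Ring H] [HopfAlgebra 𝕜 H]

lemma comul_hitRight (f : H →ₗ[𝕜] 𝕜) :
    comul ∘ₗ hitRight f = (hitRight f).lTensor H ∘ₗ comul (R := 𝕜) := by
  ext x
  have h := sum_coassoc (𝕜 := 𝕜) ((TensorProduct.rid 𝕜 (H ⊗[𝕜] H)).toLinearMap ∘ₗ
    f.lTensor (H ⊗[𝕜] H) ∘ₗ (TensorProduct.assoc 𝕜 H H H).symm.toLinearMap) x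
  simp only [LinearMap.comp_apply, LinearMap.lTensor_tmul, LinearEquiv.coe_coe,
    TensorProduct.assoc_symm_tmul,
    TensorProduct.rid_tmul, ← Finset.smul_sum, ← comul_eq_sum] at h
  simp only [LinearMap.comp_apply, hitRight_apply, map_sum, map_smul]
  rw [h, comul_eq_sum x, map_sum]
  simp [hitRight_apply, TensorProduct.tmul_sum]

lemma hitLeft_hitRight_comm (f g : H →ₗ[𝕜] 𝕜) (x : H) :
    hitLeft f (hitRight g x) = hitRight g (hitLeft f x) := by
  have h := LinearMap.congr_fun (comul_hitLeft f) x
  simp only [LinearMap.comp_apply] at h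
  simp only [hitRight, LinearMap.comp_apply, h]
  rw [comul_eq_sum]
  simp

/-- `l(a₁ x) a₂ = S(l(a x₁) x₂)` for an integral `l`. -/
lemma IsCointegral.hitLeft_mulRight {l : H →ₗ[𝕜] 𝕜} (hl : IsCointegral l) (a x : H) :
    hitLeft (l ∘ₗ LinearMap.mulRight 𝕜 x) a =
      antipode 𝕜 (hitLeft (l ∘ₗ LinearMap.mulLeft 𝕜 a) x) := by
  let P : H ⊗[𝕜] H →ₗ[𝕜] H := (TensorProduct.lid 𝕜 H).toLinearMap ∘ₗ l.rTensor H
  have hP (t : H ⊗[𝕜] H) (y : H) : P (t * (1 ⊗ₜ y)) = P t * y := by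
    induction t with
    | zero => simp
    | tmul u v => simp [P]
    | add u v hu hv => simp only [add_mul, map_add, hu, hv]
  have h1 : hitLeft (l ∘ₗ LinearMap.mulRight 𝕜 x) a = P (comul a * (x ⊗ₜ[𝕜] 1)) := by
    rw [hitLeft_apply, comul_eq_sum, Finset.sum_mul]
    simp [P]
  rw [h1, ← sum_comul_mul_antipode, Finset.mul_sum, map_sum, hitLeft_apply, map_sum]
  refine Finset.sum_congr rfl fun i _ ↦ ?_
  rw [← mul_assoc, ← Bialgebra.comul_mul, hP, map_smul]
  have := hl (a * (ℛ 𝕜 x).left i)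
  rw [hitLeft, LinearMap.comp_apply] at this
  rw [show P (comul (a * (ℛ 𝕜 x).left i)) = _ from this]
  simp

lemma mul'_lTensor_antipode_hitRight (f : H →ₗ[𝕜] 𝕜) (a : H) :
    ∑ i ∈ (ℛ 𝕜 a).index, (ℛ 𝕜 a).left i * antipode 𝕜 (hitRight f ((ℛ 𝕜 a).right i)) =
      f a • (1 : H) := by
  have h := mul_antipode_lTensor_comul_apply (R := 𝕜) (hitRight f a)
  have h2 := LinearMap.congr_fun (comul_hitRight f) a
  simp only [LinearMap.comp_apply] at h2
  rw [h2, comul_eq_sum a] at h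
  simp only [map_sum, LinearMap.lTensor_tmul, LinearMap.mul'_apply] at h
  rw [h, ← apply_hitLeft_comm, hitLeft_counit, Algebra.algebraMap_eq_smul_one]

/-- The bilinear form `(a, x) ↦ l(a x)` of a nonzero integral is nondegenerate on the left. -/
lemma IsCointegral.eq_zero_of_mulLeft [FiniteDimensional 𝕜 H] {l : H →ₗ[𝕜] 𝕜}
    (hl : IsCointegral l) (hl0 : l ≠ 0) {a : H} (ha : l ∘ₗ LinearMap.mulLeft 𝕜 a = 0) :
    a = 0 := by
  by_contra ha0
  obtain ⟨f, hf⟩ : ∃ f : Module.Dual 𝕜 H, f a ≠ 0 := by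
    by_contra! h
    exact ha0 ((Module.forall_dual_apply_eq_zero_iff 𝕜 a).1 h)
  have h1 (x : H) : hitLeft (l ∘ₗ LinearMap.mulRight 𝕜 x) a = 0 := by
    rw [hl.hitLeft_mulRight, ha]
    simp [hitLeft]
  -- From l(a₁x) a₂ = 0 for all x it follows that l(a₁ X(a₂)) = 0 for every linear X, on expanding X
  -- in a basis.
  have h2 (X : H →ₗ[𝕜] H) : ∑ i ∈ (ℛ 𝕜 a).index,
      l ((ℛ 𝕜 a).left i * X ((ℛ 𝕜 a).right i)) = 0 := by
    let b := Module.finBasis 𝕜 H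
    have hb (w : H) : X w = ∑ j, b.coord j w • X (b j) := by
      conv_lhs => rw [← b.sum_repr w, map_sum]
      simp only [map_smul]
      rfl
    have h3 (j) : ∑ i ∈ (ℛ 𝕜 a).index, b.coord j ((ℛ 𝕜 a).right i) *
        l ((ℛ 𝕜 a).left i * X (b j)) = 0 := by
      have := congrArg (b.coord j) (h1 (X (b j)))
      rw [hitLeft_apply, map_sum, map_zero] at this
      simpa only [map_smul, LinearMap.comp_apply, LinearMap.mulRight_apply, smul_eq_mul,
        mul_comm] using this
    have h4 (i) : l ((ℛ 𝕜 a).left i * X ((ℛ 𝕜 a).right i)) =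
        ∑ j, b.coord j ((ℛ 𝕜 a).right i) * l ((ℛ 𝕜 a).left i * X (b j)) := by
      rw [hb, Finset.mul_sum, map_sum]
      simp only [mul_smul_comm, map_smul, smul_eq_mul]
    simp only [h4]
    rw [Finset.sum_comm]
    exact Finset.sum_eq_zero fun j _ ↦ h3 j
  apply hl0
  ext y
  -- With X(z) = S(z₁ f(z₂)) y the sum a₁ X(a₂) telescopes to f(a) y, so l(y) = 0 for all y.
  have h3 := h2 (LinearMap.mulRight 𝕜 y ∘ₗ antipode 𝕜 ∘ₗ hitRight f)
  simp only [LinearMap.comp_apply, LinearMap.mulRight_apply, ← mul_assoc] at h3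
  rw [← map_sum, ← Finset.sum_mul, mul'_lTensor_antipode_hitRight] at h3
  simpa [hf] using h3

lemma IsCointegral.exists_mulLeft_eq [FiniteDimensional 𝕜 H] {l : H →ₗ[𝕜] 𝕜}
    (hl : IsCointegral l) (hl0 : l ≠ 0) (f : H →ₗ[𝕜] 𝕜) :
    ∃ a, l ∘ₗ LinearMap.mulLeft 𝕜 a = f := by
  let T : H →ₗ[𝕜] (Module.Dual 𝕜 H) := (LinearMap.mul 𝕜 H).compr₂ l
  have hT (a : H) : T a = l ∘ₗ LinearMap.mulLeft 𝕜 a := rfl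
  have hinj : Function.Injective T :=
    (injective_iff_map_eq_zero T).2 fun a ha ↦ hl.eq_zero_of_mulLeft hl0 ha
  have hsurj := (LinearMap.injective_iff_surjective_of_finrank_eq_finrank
    (Subspace.dual_finrank_eq (K := 𝕜) (V := H)).symm).1 hinj
  exact hsurj f

lemma IsCointegral.eq_zero_of_mulRight [FiniteDimensional 𝕜 H] {l : H →ₗ[𝕜] 𝕜}
    (hl : IsCointegral l) (hl0 : l ≠ 0) {x : H} (hx : l ∘ₗ LinearMap.mulRight 𝕜 x = 0) :
    x = 0 := by
  rw [← Module.forall_dual_apply_eq_zero_iff 𝕜]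
  intro f
  obtain ⟨a, rfl⟩ := hl.exists_mulLeft_eq hl0 f
  exact LinearMap.congr_fun hx a

lemma IsCointegral.exists_mulRight_eq [FiniteDimensional 𝕜 H] {l : H →ₗ[𝕜] 𝕜}
    (hl : IsCointegral l) (hl0 : l ≠ 0) (f : H →ₗ[𝕜] 𝕜) :
    ∃ x, l ∘ₗ LinearMap.mulRight 𝕜 x = f := by
  let T : H →ₗ[𝕜] (Module.Dual 𝕜 H) := (LinearMap.mul 𝕜 H).flip.compr₂ l
  have hT (a : H) : T a = l ∘ₗ LinearMap.mulRight 𝕜 a := rfl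
  have hinj : Function.Injective T :=
    (injective_iff_map_eq_zero T).2 fun a ha ↦ hl.eq_zero_of_mulRight hl0 ha
  have hsurj := (LinearMap.injective_iff_surjective_of_finrank_eq_finrank
    (Subspace.dual_finrank_eq (K := 𝕜) (V := H)).symm).1 hinj
  exact hsurj f

/-- Choosing x with l(·x) = ε turns the identity for l(a₁x) a₂ into an explicit preimage of a under
S. -/
lemma antipode_bijective [CharZero 𝕜] [FiniteDimensional 𝕜 H] :
    Function.Bijective (antipode 𝕜 : H →ₗ[𝕜] H) := by
  obtain ⟨l, hl, hl0⟩ := exists_isCointegral_ne_zero (𝕜 := 𝕜) (H := H)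
  have hs : Function.Surjective (antipode 𝕜 : H →ₗ[𝕜] H) := by
    intro a
    obtain ⟨x, hx⟩ := hl.exists_mulRight_eq hl0 (counit (R := 𝕜))
    refine ⟨hitLeft (l ∘ₗ LinearMap.mulLeft 𝕜 a) x, ?_⟩
    rw [← hl.hitLeft_mulRight, hx, hitLeft_counit]
  exact ⟨LinearMap.injective_iff_surjective.2 hs, hs⟩

lemma antipodeSq_bijective [CharZero 𝕜] [FiniteDimensional 𝕜 H] :
    Function.Bijective (antipodeSq 𝕜 H) :=
  antipode_bijective.comp antipode_bijective

/-- If `Tr(x ↦ S²(x) e) ≠ 0` for some `e` then the Hopf algebra is semisimple. -/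
theorem isSemisimpleRing_of_trace_ne_zero [CharZero 𝕜] [FiniteDimensional 𝕜 H] (e : H)
    (he : LinearMap.trace 𝕜 H (LinearMap.mulRight 𝕜 e ∘ₗ (antipodeSq 𝕜 H).toLinearMap) ≠ 0) :
    IsSemisimpleRing H := by
  have hart : IsArtinianRing H := IsArtinianRing.of_finite 𝕜 H
  rw [IsArtinianRing.isSemisimpleRing_iff_jacobson, eq_bot_iff]
  have hl : IsCointegral (traceForm (LinearMap.id : H →ₗ[𝕜] H)) :=
    isCointegral_traceForm _ (by simp)
  have hl0 : traceForm (LinearMap.id : H →ₗ[𝕜] H) ≠ 0 := fun h ↦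
    he (LinearMap.congr_fun h e)
  obtain ⟨m, hm⟩ := IsSemiprimaryRing.isNilpotent (R := H)
  have hJ : Ring.jacobson H ≤ (Ring.jacobson H).comap (antipodeSq 𝕜 H).toRingHom := by
    have : RingHomSurjective (antipodeSq 𝕜 H).toRingHom := ⟨antipodeSq_bijective.2⟩
    exact Ring.le_comap_jacobson _
  have hJn (n : ℕ) : Ring.jacobson H ^ n ≤
      (Ring.jacobson H ^ n).comap (antipodeSq 𝕜 H).toRingHom := by
    induction n with
    | zero => simp [Submodule.pow_zero, Ideal.one_eq_top]
    | succ n ih =>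
      rw [Submodule.pow_succ]
      refine Ideal.mul_le.2 fun r hr s hs ↦ ?_
      rw [Ideal.mem_comap, map_mul]
      exact Ideal.mul_mem_mul (ih hr) (hJ hs)
  intro a ha
  refine hl.eq_zero_of_mulLeft hl0 ?_
  ext y
  have hay : a * y ∈ Ring.jacobson H := Ideal.mul_mem_right y _ ha
  -- The trace of this operator is l(ay). Since S² preserves the radical and its powers, each
  -- application of F climbs one power of the radical, so F is nilpotent.
  let F : Module.End 𝕜 H := LinearMap.mulRight 𝕜 (a * y) ∘ₗ (antipodeSq 𝕜 H).toLinearMap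
  have hF (n : ℕ) (x : H) : (F ^ n) x ∈ Ring.jacobson H ^ n := by
    induction n with
    | zero => simp [Submodule.pow_zero, Ideal.one_eq_top]
    | succ n ih =>
      rw [pow_succ' F, Submodule.pow_succ]
      exact Ideal.mul_mem_mul (hJn n ih) hay
  have hnil : IsNilpotent F := ⟨m, by
    ext x
    have := hF m x
    rw [hm] at this
    simpa using this⟩
  exact (LinearMap.isNilpotent_trace_of_isNilpotent hnil).eq_zero

end Nondegenerate
end HopfAlgebra

namespace HopfAlgebra

open Coalgebra

/-! ### Radford's formula for S⁴ -/

section Radford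

variable {𝕜 H : Type*} [Field 𝕜] [Ring H] [HopfAlgebra 𝕜 H]

lemma dual_ext {V : Type*} [AddCommGroup V] [Module 𝕜 V] {x y : V}
    (h : ∀ q : V →ₗ[𝕜] 𝕜, q x = q y) : x = y := by
  rw [← sub_eq_zero, ← Module.forall_dual_apply_eq_zero_iff 𝕜]
  intro q
  rw [map_sub, h, sub_self]

lemma counit_hitRight (f : H →ₗ[𝕜] 𝕜) (x : H) : counit (R := 𝕜) (hitRight f x) = f x := by
  rw [← apply_hitLeft_comm, hitLeft_counit]

lemma counit_hitLeft (f : H →ₗ[𝕜] 𝕜) (x : H) : counit (R := 𝕜) (hitLeft f x) = f x := by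
  rw [apply_hitLeft_comm, hitRight_counit]

lemma hitLeft_comp_hitRight (f g : H →ₗ[𝕜] 𝕜) (x : H) :
    hitLeft (f ∘ₗ hitRight g) x = hitLeft g (hitLeft f x) := by
  refine dual_ext (𝕜 := 𝕜) fun q ↦ ?_
  rw [apply_hitLeft_comm, apply_hitLeft_comm g, ← hitLeft_hitRight_comm, apply_hitLeft_comm]
  rfl

/-- Uniqueness of integrals. -/
lemma IsCointegral.exists_eq_smul [FiniteDimensional 𝕜 H] {l l' : H →ₗ[𝕜] 𝕜}
    (hl : IsCointegral l) (hl0 : l ≠ 0) (hl' : IsCointegral l') : ∃ c : 𝕜, l' = c • l := by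
  obtain ⟨b, rfl⟩ := hl.exists_mulLeft_eq hl0 l'
  have h1 (q : H →ₗ[𝕜] 𝕜) : hitRight q b = q 1 • b := by
    rw [← sub_eq_zero]
    refine hl.eq_zero_of_mulLeft hl0 (LinearMap.ext fun x ↦ ?_)
    have h := congrArg q (hl.hitLeft_mulRight b x)
    rw [hl', apply_hitLeft_comm] at h
    simpa [sub_mul, sub_eq_zero, mul_comm] using h
  -- By `h1`, b₁ q(b₂) = q(1) b for all q, which forces b to be a scalar; hence l' is a multiple of
  -- l.
  have h2 : b = counit (R := 𝕜) b • (1 : H) := by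
    refine dual_ext (𝕜 := 𝕜) fun q ↦ ?_
    rw [← counit_hitRight q b, h1]
    simp [mul_comm]
  refine ⟨counit (R := 𝕜) b, LinearMap.ext fun x ↦ ?_⟩
  rw [LinearMap.comp_apply, LinearMap.mulLeft_apply, h2]
  simp

/-- The distinguished group-like element of a finite-dimensional Hopf algebra. -/
lemma IsCointegral.exists_groupLike [FiniteDimensional 𝕜 H] {l : H →ₗ[𝕜] 𝕜}
    (hl : IsCointegral l) (hl0 : l ≠ 0) :
    ∃ g : H, IsGroupLikeElem 𝕜 g ∧ ∀ a, hitRight l a = l a • g := by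
  obtain ⟨a₀, ha₀⟩ : ∃ a₀, l a₀ = 1 := by
    obtain ⟨a, ha⟩ : ∃ a, l a ≠ 0 := by
      by_contra! h
      exact hl0 (LinearMap.ext h)
    exact ⟨(l a)⁻¹ • a, by simp [ha]⟩
  have hg (a : H) : hitRight l a = l a • hitRight l a₀ := by
    refine dual_ext (𝕜 := 𝕜) fun q ↦ ?_
    -- Right translation preserves the space of integrals; as this space is a line, l translates
    -- into multiples of itself, and g records the factor.
    have hq : IsCointegral (q ∘ₗ hitRight l) := fun x ↦ by
      rw [hitLeft_comp_hitRight, hl, LinearMap.comp_apply, apply_hitLeft_comm]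
    obtain ⟨c, hc⟩ := hl.exists_eq_smul hl0 hq
    have h1 (x : H) : q (hitRight l x) = c * l x := LinearMap.congr_fun hc x
    rw [map_smul, h1, h1, ha₀, smul_eq_mul]
    ring
  refine ⟨hitRight l a₀, ⟨by rw [counit_hitRight, ha₀], ?_⟩, hg⟩
  have h := LinearMap.congr_fun (comul_hitRight l) a₀
  simp only [LinearMap.comp_apply] at h
  rw [h, comul_eq_sum, map_sum]
  simp only [LinearMap.lTensor_tmul]
  conv_rhs => rw [hitRight_apply l a₀, TensorProduct.sum_tmul]
  refine Finset.sum_congr rfl fun i _ ↦ ?_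
  rw [hg, TensorProduct.tmul_smul, TensorProduct.smul_tmul', ← hitRight_apply]

/-- Mirror image of `IsCointegral.hitLeft_mulRight`. The factor g appears because l is an integral
on one side only and the other side yields g instead of 1. -/
lemma hitRight_mulLeft_eq {l : H →ₗ[𝕜] 𝕜} {g : H} (hg : ∀ a, hitRight l a = l a • g) (a x : H) :
    hitRight (l ∘ₗ LinearMap.mulLeft 𝕜 a) x =
      antipode 𝕜 (hitRight (l ∘ₗ LinearMap.mulRight 𝕜 x) a) * g := by
  let P : H ⊗[𝕜] H →ₗ[𝕜] H := (TensorProduct.rid 𝕜 H).toLinearMap ∘ₗ l.lTensor H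
  have hP (t : H ⊗[𝕜] H) (y : H) : P ((y ⊗ₜ 1) * t) = y * P t := by
    induction t with
    | zero => simp
    | tmul u v => simp [P]
    | add u v hu hv => simp only [mul_add, map_add, hu, hv]
  have h1 : hitRight (l ∘ₗ LinearMap.mulLeft 𝕜 a) x = P ((1 ⊗ₜ[𝕜] a) * comul x) := by
    rw [hitRight_apply, comul_eq_sum, Finset.mul_sum]
    simp [P]
  rw [h1, ← sum_antipode_mul_comul, Finset.sum_mul, map_sum, hitRight_apply, map_sum,
    Finset.sum_mul]
  refine Finset.sum_congr rfl fun i _ ↦ ?_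
  rw [mul_assoc, ← Bialgebra.comul_mul, hP, map_smul]
  have := hg ((ℛ 𝕜 a).right i * x)
  rw [hitRight, LinearMap.comp_apply] at this
  rw [show P (comul ((ℛ 𝕜 a).right i * x)) = _ from this]
  simp

/-- The Nakayama automorphism of the Frobenius form of an integral. -/
lemma IsCointegral.exists_nakayama [FiniteDimensional 𝕜 H] {l : H →ₗ[𝕜] 𝕜}
    (hl : IsCointegral l) (hl0 : l ≠ 0) :
    ∃ ν : H →ₐ[𝕜] H, ∀ a x, l (a * x) = l (x * ν a) := by
  choose ν hν using fun a ↦ hl.exists_mulRight_eq hl0 (l ∘ₗ LinearMap.mulLeft 𝕜 a)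
  have hν' (a x : H) : l (x * ν a) = l (a * x) := LinearMap.congr_fun (hν a) x
  have huniq {u v : H} (h : ∀ x, l (x * u) = l (x * v)) : u = v := by
    rw [← sub_eq_zero]
    refine hl.eq_zero_of_mulRight hl0 (LinearMap.ext fun x ↦ ?_)
    simp [mul_sub, h]
  refine ⟨AlgHom.ofLinearMap ⟨⟨ν, fun a b ↦ huniq fun x ↦ ?_⟩, fun c a ↦ huniq fun x ↦ ?_⟩
    (huniq fun x ↦ ?_) fun a b ↦ huniq fun x ↦ ?_, fun a x ↦ (hν' a x).symm⟩
  · simp [mul_add, add_mul, hν']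
  · simp [hν']
  · simp [hν']
  · change l (x * ν (a * b)) = l (x * (ν a * ν b))
    rw [hν', ← mul_assoc, hν', ← mul_assoc, hν', mul_assoc]

/-- Radford's formula for the fourth power of the antipode. -/
theorem exists_antipodeSq_antipodeSq_eq [CharZero 𝕜] [FiniteDimensional 𝕜 H] :
    ∃ (g : H) (α : H →ₐ[𝕜] 𝕜), IsGroupLikeElem 𝕜 g ∧
      Function.Injective (hitLeft α.toLinearMap) ∧
      ∀ a, antipodeSq 𝕜 H (antipodeSq 𝕜 H (hitRight α.toLinearMap a)) =
        g * hitLeft α.toLinearMap a * antipode 𝕜 g := by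
  obtain ⟨l, hl, hl0⟩ := exists_isCointegral_ne_zero (𝕜 := 𝕜) (H := H)
  obtain ⟨g, hg, hlg⟩ := hl.exists_groupLike hl0
  obtain ⟨ν, hν⟩ := hl.exists_nakayama hl0
  have hνL (a : H) : l ∘ₗ LinearMap.mulLeft 𝕜 a = l ∘ₗ LinearMap.mulRight 𝕜 (ν a) :=
    LinearMap.ext fun x ↦ hν a x
  have hνR (x : H) : l ∘ₗ LinearMap.mulRight 𝕜 x = (l ∘ₗ LinearMap.mulLeft 𝕜 x) ∘ₗ
    ν.toLinearMap := LinearMap.ext fun a ↦ hν a x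
  let α : H →ₐ[𝕜] 𝕜 := (Bialgebra.counitAlgHom 𝕜 H).comp ν
  have hα : α.toLinearMap = counit ∘ₗ ν.toLinearMap := rfl
  -- With l(x·) = ε, applying each exchange identity twice expresses the Nakayama automorphism in
  -- two ways, through left hits (`h3`) and through right hits (`h4`). Eliminating ν gives Radford's
  -- formula.
  obtain ⟨x, hx⟩ := hl.exists_mulLeft_eq hl0 (counit (R := 𝕜))
  have h3 (a : H) : hitLeft α.toLinearMap a = antipodeSq 𝕜 H (ν a) := by
    have h := hl.hitLeft_mulRight a x
    rwa [hνR, hx, hνL, hl.hitLeft_mulRight, hx, hitLeft_counit, ← hα] at h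
  have h4 (a : H) : ν a = antipode 𝕜 g * antipodeSq 𝕜 H (hitRight α.toLinearMap a) * g := by
    have h := hitRight_mulLeft_eq hlg a x
    have h' := hitRight_mulLeft_eq hlg x (ν a)
    rw [← hνL, h, hνR, hx, hitRight_counit, antipode_mul_antidistrib, ← hα] at h'
    rw [h']
    rfl
  refine ⟨g, α, hg, ?_, fun a ↦ ?_⟩
  · have hνinj : Function.Injective ν := (injective_iff_map_eq_zero ν).2 fun a ha ↦
      hl.eq_zero_of_mulLeft hl0 (LinearMap.ext fun x ↦ by simp [hν, ha])
    rw [show ⇑(hitLeft α.toLinearMap) = antipodeSq 𝕜 H ∘ ν from funext h3]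
    exact antipodeSq_bijective.1.comp hνinj
  · rw [h3, h4]
    simp only [map_mul]
    rw [antipodeSq_apply g, hg.antipode_antipode, antipodeSq_apply (antipode 𝕜 g),
      hg.antipode_antipode]
    simp only [← mul_assoc, hg.mul_antipode_cancel, one_mul]
    simp only [mul_assoc, hg.mul_antipode_cancel, mul_one]

end Radford
end HopfAlgebra

/-! ### Traces of operators of finite order -/

section TraceOfRootsOfUnity

variable {𝕜 : Type*} [Field 𝕜] [CharZero 𝕜]

/-- A prime l is not a unit among the algebraic integers, because 1/l is rational and not an
integer. -/
lemma exists_isMaximal_natCast_mem_integralClosure {l : ℕ} (hl : l.Prime) :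
    ∃ P : Ideal (integralClosure ℤ 𝕜), P.IsMaximal ∧ (l : integralClosure ℤ 𝕜) ∈ P := by
  have h : ¬ IsUnit (l : integralClosure ℤ 𝕜) := by
    intro hu
    obtain ⟨y, hy⟩ := hu.exists_right_inv
    have hy' : (l : 𝕜) * (y : 𝕜) = 1 := by
      have := congrArg (fun z : integralClosure ℤ 𝕜 ↦ (z : 𝕜)) hy
      simpa using this
    have hl0 : (l : 𝕜) ≠ 0 := Nat.cast_ne_zero.2 hl.ne_zero
    have hy2 : (y : 𝕜) = algebraMap ℚ 𝕜 ((l : ℚ)⁻¹) := by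
      rw [map_inv₀, map_natCast]
      exact eq_inv_of_mul_eq_one_right hy'
    have hint : IsIntegral ℤ (algebraMap ℚ 𝕜 ((l : ℚ)⁻¹)) := hy2 ▸ y.2
    rw [isIntegral_algebraMap_iff (algebraMap ℚ 𝕜).injective,
      IsIntegrallyClosed.isIntegral_iff] at hint
    obtain ⟨z, hz⟩ := hint
    have hlq : (l : ℚ) ≠ 0 := Nat.cast_ne_zero.2 hl.ne_zero
    have h1 : (z : ℚ) * l = 1 := by
      rw [show (z : ℚ) = (l : ℚ)⁻¹ from hz, inv_mul_cancel₀ hlq]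
    have h2 : z * (l : ℤ) = 1 := by exact_mod_cast h1
    have h3 : IsUnit (l : ℤ) := IsUnit.of_mul_eq_one _ (by rw [mul_comm]; exact h2)
    exact (Nat.prime_iff_prime_int.1 hl).not_isUnit h3
  obtain ⟨P, hP, hlP⟩ := exists_max_ideal_of_mem_nonunits h
  exact ⟨P, hP, hlP⟩

variable [IsAlgClosed 𝕜] {V : Type*} [AddCommGroup V] [Module 𝕜 V] [FiniteDimensional 𝕜 V]

/-- An endomorphism of `l`-power order and trace zero lives on a space of dimension divisible
by `l`. -/
lemma dvd_finrank_of_trace_eq_zero {l r : ℕ} (hl : l.Prime) {f : Module.End 𝕜 V}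
    (hf : f ^ l ^ r = 1) (htr : LinearMap.trace 𝕜 V f = 0) : l ∣ Module.finrank 𝕜 V := by
  obtain ⟨P, hP, hlP⟩ := exists_isMaximal_natCast_mem_integralClosure (𝕜 := 𝕜) hl
  let F := integralClosure ℤ 𝕜 ⧸ P
  let : Field F := Ideal.Quotient.field P
  have : Fact l.Prime := ⟨hl⟩
  have hchar : CharP F l := by
    rw [CharP.charP_iff_prime_eq_zero hl, ← map_natCast (Ideal.Quotient.mk P)]
    exact Ideal.Quotient.eq_zero_iff_mem.2 hlP
  -- Each l^r-th root of unity reduces to 1 in the residue field of characteristic l, so a sum of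
  -- such roots reduces to their number. Applied to the eigenvalues, this gives trace ≡ dim mod P.
  have hsum (s : Multiset 𝕜) (hs : ∀ x ∈ s, x ^ l ^ r = 1) :
      ∃ y : integralClosure ℤ 𝕜, (y : 𝕜) = s.sum ∧ Ideal.Quotient.mk P y = (s.card : F) := by
    induction s using Multiset.induction_on with
    | empty => exact ⟨0, by simp⟩
    | cons x s ih =>
      obtain ⟨y, hy, hy'⟩ := ih fun z hz ↦ hs z (Multiset.mem_cons_of_mem hz)
      have hx := hs x (Multiset.mem_cons_self x s)
      have hxi : IsIntegral ℤ x := by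
        refine IsIntegral.of_pow (n := l ^ r) (pow_pos hl.pos r) ?_
        rw [hx]
        exact isIntegral_one
      let X : integralClosure ℤ 𝕜 := ⟨x, hxi⟩
      have hX : X ^ l ^ r = 1 := Subtype.ext (by simpa [X] using hx)
      have hX1 : Ideal.Quotient.mk P X = (1 : F) := by
        have h : (Ideal.Quotient.mk P X - 1 : F) ^ l ^ r = 0 := by
          rw [sub_pow_char_pow, one_pow, ← map_pow, hX, map_one, sub_self]
        exact sub_eq_zero.1 (pow_eq_zero_iff (pow_pos hl.pos r).ne' |>.1 h)
      refine ⟨X + y, by simp [X, hy], ?_⟩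
      rw [map_add, hX1, hy', Multiset.card_cons]
      push_cast
      ring
  have hroots : ∀ x ∈ f.charpoly.roots, x ^ l ^ r = 1 := by
    intro x hx
    have hev : f.HasEigenvalue x := by
      rw [Module.End.hasEigenvalue_iff_isRoot_charpoly]
      exact Polynomial.isRoot_of_mem_roots hx
    obtain ⟨v, hv⟩ := hev.exists_hasEigenvector
    have h := hv.pow_apply (l ^ r)
    rw [hf, Module.End.one_apply] at h
    have h2 : (x ^ l ^ r - 1) • v = 0 := by rw [sub_smul, ← h, one_smul, sub_self]
    exact sub_eq_zero.1 ((smul_eq_zero.1 h2).resolve_right hv.2)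
  obtain ⟨y, hy, hy'⟩ := hsum _ hroots
  have hsplit : f.charpoly.Splits := IsAlgClosed.splits _
  rw [← Module.End.trace_eq_sum_roots_charpoly_of_splits hsplit, htr] at hy
  have hy0 : y = 0 := Subtype.ext hy
  rw [hy0, map_zero, ← hsplit.natDegree_eq_card_roots, LinearMap.charpoly_natDegree] at hy'
  exact (CharP.cast_eq_zero_iff F l _).1 hy'.symm

/-- If all powers of an operator `T ≠ 1` of prime order `l` have trace `0` or `dim V`, then `l`
divides `dim V`. -/
lemma dvd_finrank_of_trace_mul_trace {l : ℕ} (hl : l.Prime) {T : Module.End 𝕜 V}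
    (hT : T ^ l = 1) (hT1 : T ≠ 1)
    (htr : ∀ j, LinearMap.trace 𝕜 V (T ^ j) * LinearMap.trace 𝕜 V (T ^ j) =
      Module.finrank 𝕜 V * LinearMap.trace 𝕜 V (T ^ j)) : l ∣ Module.finrank 𝕜 V := by
  by_cases h : ∃ j, LinearMap.trace 𝕜 V (T ^ j) = 0
  · obtain ⟨j, hj⟩ := h
    refine dvd_finrank_of_trace_eq_zero (r := 1) hl (f := T ^ j) ?_ hj
    rw [pow_one, ← pow_mul, mul_comm, pow_mul, hT, one_pow]
  · push Not at h
    exfalso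
    apply hT1
    have hl0 : (l : 𝕜) ≠ 0 := Nat.cast_ne_zero.2 hl.ne_zero
    have htr' (j : ℕ) : LinearMap.trace 𝕜 V (T ^ j) = Module.finrank 𝕜 V :=
      mul_right_cancel₀ (h j) (htr j)
    -- If no trace vanishes, all of them equal dim V. The averaging projector then has trace dim V,
    -- so it is the identity, and T = 1.
    let E : Module.End 𝕜 V := (l : 𝕜)⁻¹ • ∑ j ∈ Finset.range l, T ^ j
    have hTE : T * E = E := by
      simp only [E, mul_smul_comm, Finset.mul_sum, ← pow_succ']
      congr 1
      have h1 := Finset.sum_range_succ (fun j ↦ T ^ j) l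
      rw [Finset.sum_range_succ', hT, pow_zero] at h1
      exact add_right_cancel h1
    have hTjE (j : ℕ) : T ^ j * E = E := by
      induction j with
      | zero => rw [pow_zero, one_mul]
      | succ j ih => rw [pow_succ, mul_assoc, hTE, ih]
    have hEE : IsIdempotentElem E := by
      change E * E = E
      conv_lhs => enter [1]; unfold E
      rw [smul_mul_assoc, Finset.sum_mul]
      simp only [hTjE, Finset.sum_const, Finset.card_range]
      rw [← Nat.cast_smul_eq_nsmul 𝕜, smul_smul, inv_mul_cancel₀ hl0, one_smul]
    have htrE : LinearMap.trace 𝕜 V (1 - E) = 0 := by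
      rw [map_sub, LinearMap.trace_one]
      simp only [E, map_smul, map_sum, htr', Finset.sum_const, Finset.card_range, smul_eq_mul,
        nsmul_eq_mul]
      rw [inv_mul_cancel_left₀ hl0, sub_self]
    have hE1 : 1 - E = 0 := LinearMap.IsIdempotentElem.eq_zero_of_trace_eq_zero hEE.one_sub htrE
    rwa [← sub_eq_zero.1 hE1, mul_one] at hTE

end TraceOfRootsOfUnity

/-! ### Orders of group-like elements and of comodule algebra automorphisms -/

lemma LinearMap.trace_eq_of_surjective_of_comp_eq {𝕜 V : Type*} [Field 𝕜] [AddCommGroup V]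
    [Module 𝕜 V] [FiniteDimensional 𝕜 V] {A B ψ : V →ₗ[𝕜] V} (hψ : Function.Surjective ψ)
    (h : ψ ∘ₗ A = B ∘ₗ ψ) : LinearMap.trace 𝕜 V A = LinearMap.trace 𝕜 V B := by
  let e := LinearEquiv.ofBijective ψ ⟨LinearMap.injective_iff_surjective.2 hψ, hψ⟩
  rw [← LinearMap.trace_conj' A e]
  congr 1
  ext x
  rw [LinearEquiv.conj_apply]
  change (ψ ∘ₗ A) (e.symm x) = _
  rw [h]
  change B (e (e.symm x)) = _
  rw [e.apply_symm_apply]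

namespace HopfAlgebra

open Coalgebra

section Orders

variable {𝕜 H : Type*} [Field 𝕜] [Ring H] [HopfAlgebra 𝕜 H]

/-- The isomorphism a ⊗ b ↦ Δ(a)(1 ⊗ b) carries g ⊗ id to g ⊗ g, so the two traces on H ⊗ H agree.
-/
lemma trace_mulLeft_mul_trace_mulLeft [FiniteDimensional 𝕜 H] {g : H}
    (hg : IsGroupLikeElem 𝕜 g) :
    LinearMap.trace 𝕜 H (LinearMap.mulLeft 𝕜 g) * LinearMap.trace 𝕜 H (LinearMap.mulLeft 𝕜 g) =
      Module.finrank 𝕜 H * LinearMap.trace 𝕜 H (LinearMap.mulLeft 𝕜 g) := by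
  let ψ : H ⊗[𝕜] H →ₗ[𝕜] H ⊗[𝕜] H := LinearMap.mul' 𝕜 (H ⊗[𝕜] H) ∘ₗ
    TensorProduct.map comul (TensorProduct.mk 𝕜 H H 1)
  have hψ (a b : H) : ψ (a ⊗ₜ b) = comul a * (1 ⊗ₜ b) := rfl
  have hsurj : Function.Surjective ψ := by
    rw [← LinearMap.range_eq_top, eq_top_iff, ← TensorProduct.span_tmul_eq_top,
      Submodule.span_le]
    rintro _ ⟨a, b, rfl⟩
    refine ⟨∑ i ∈ (ℛ 𝕜 a).index, (ℛ 𝕜 a).left i ⊗ₜ (antipode 𝕜 ((ℛ 𝕜 a).right i) * b), ?_⟩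
    have h := congrArg (· * ((1 : H) ⊗ₜ[𝕜] b)) (sum_comul_mul_antipode (𝕜 := 𝕜) a)
    simp only [Finset.sum_mul, mul_assoc, Algebra.TensorProduct.tmul_mul_tmul, one_mul,
      mul_one] at h
    rw [map_sum]
    simpa only [hψ] using h
  have h : ψ ∘ₗ TensorProduct.map (LinearMap.mulLeft 𝕜 g) LinearMap.id =
      TensorProduct.map (LinearMap.mulLeft 𝕜 g) (LinearMap.mulLeft 𝕜 g) ∘ₗ ψ := by
    ext a b
    simp only [TensorProduct.AlgebraTensorModule.curry_apply, TensorProduct.curry_apply,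
      LinearMap.restrictScalars_self, LinearMap.comp_apply, TensorProduct.map_tmul, hψ,
      LinearMap.mulLeft_apply, LinearMap.id_apply, Bialgebra.comul_mul, hg.comul_eq_tmul_self]
    rw [mul_assoc]
    generalize comul a * ((1 : H) ⊗ₜ[𝕜] b) = t
    induction t with
    | zero => simp
    | tmul u v => simp
    | add u v hu hv => simp only [mul_add, map_add, hu, hv]
  have h2 := LinearMap.trace_eq_of_surjective_of_comp_eq hsurj h
  rw [LinearMap.trace_tensorProduct', LinearMap.trace_tensorProduct', LinearMap.trace_id] at h2
  rw [← h2, mul_comm]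

/-- Dual version: a ⊗ b ↦ (b ⊗ 1)Δ(a) carries T ⊗ T to T ⊗ id. Multiplicativity of T handles b, the
comodule property handles Δ(a). -/
lemma trace_mul_trace_of_comul_comp [FiniteDimensional 𝕜 H] (T : H →ₐ[𝕜] H)
    (hT : comul ∘ₗ T.toLinearMap = T.toLinearMap.rTensor H ∘ₗ comul (R := 𝕜)) :
    LinearMap.trace 𝕜 H T.toLinearMap * LinearMap.trace 𝕜 H T.toLinearMap =
      Module.finrank 𝕜 H * LinearMap.trace 𝕜 H T.toLinearMap := by
  let ψ : H ⊗[𝕜] H →ₗ[𝕜] H ⊗[𝕜] H := LinearMap.mul' 𝕜 (H ⊗[𝕜] H) ∘ₗ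
    TensorProduct.map ((TensorProduct.mk 𝕜 H H).flip 1) comul ∘ₗ
    (TensorProduct.comm 𝕜 H H).toLinearMap
  have hψ (a b : H) : ψ (a ⊗ₜ b) = (b ⊗ₜ 1) * comul a := rfl
  have hT' (a : H) : comul (R := 𝕜) (T a) = T.toLinearMap.rTensor H (comul a) :=
    LinearMap.congr_fun hT a
  have hsurj : Function.Surjective ψ := by
    rw [← LinearMap.range_eq_top, eq_top_iff, ← TensorProduct.span_tmul_eq_top,
      Submodule.span_le]
    rintro _ ⟨u, v, rfl⟩
    refine ⟨∑ i ∈ (ℛ 𝕜 v).index, (ℛ 𝕜 v).right i ⊗ₜ (u * antipode 𝕜 ((ℛ 𝕜 v).left i)), ?_⟩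
    have h := congrArg ((u ⊗ₜ[𝕜] (1 : H)) * ·) (sum_antipode_mul_comul (𝕜 := 𝕜) v)
    simp only [Finset.mul_sum, ← mul_assoc, Algebra.TensorProduct.tmul_mul_tmul, one_mul,
      mul_one] at h
    rw [map_sum]
    simpa only [hψ] using h
  have h : ψ ∘ₗ TensorProduct.map T.toLinearMap T.toLinearMap =
      TensorProduct.map T.toLinearMap LinearMap.id ∘ₗ ψ := by
    ext a b
    simp only [TensorProduct.AlgebraTensorModule.curry_apply, TensorProduct.curry_apply,
      LinearMap.restrictScalars_self, LinearMap.comp_apply, TensorProduct.map_tmul, hψ,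
      AlgHom.toLinearMap_apply, hT']
    generalize comul (R := 𝕜) a = t
    induction t with
    | zero => simp
    | tmul u v => simp
    | add u v hu hv => simp only [mul_add, map_add, hu, hv]
  have h2 := LinearMap.trace_eq_of_surjective_of_comp_eq hsurj h
  rw [LinearMap.trace_tensorProduct', LinearMap.trace_tensorProduct', LinearMap.trace_id] at h2
  rw [h2, mul_comm]

/-- The order of a group-like element of prime order divides the dimension. -/
lemma dvd_finrank_of_isGroupLikeElem [IsAlgClosed 𝕜] [CharZero 𝕜] [FiniteDimensional 𝕜 H] {l : ℕ}
    (hl : l.Prime) {g : H} (hg : IsGroupLikeElem 𝕜 g) (hgl : g ^ l = 1) (hg1 : g ≠ 1) :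
    l ∣ Module.finrank 𝕜 H := by
  refine dvd_finrank_of_trace_mul_trace hl (T := LinearMap.mulLeft 𝕜 g) ?_ ?_ fun j ↦ ?_
  · rw [LinearMap.pow_mulLeft, hgl]; ext; simp
  · intro h
    exact hg1 (by simpa using LinearMap.congr_fun h 1)
  · rw [LinearMap.pow_mulLeft]
    exact trace_mulLeft_mul_trace_mulLeft hg.pow

lemma comul_pow_toLinearMap {T : H →ₐ[𝕜] H}
    (hT : comul ∘ₗ T.toLinearMap = T.toLinearMap.rTensor H ∘ₗ comul (R := 𝕜)) (j : ℕ) :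
    comul ∘ₗ (T ^ j).toLinearMap = (T ^ j).toLinearMap.rTensor H ∘ₗ comul (R := 𝕜) := by
  induction j with
  | zero =>
    ext x
    simp [show (1 : H →ₐ[𝕜] H).toLinearMap = LinearMap.id from rfl]
  | succ j ih =>
    have h1 : (T ^ (j + 1)).toLinearMap = (T ^ j).toLinearMap ∘ₗ T.toLinearMap := by
      rw [pow_succ]; rfl
    rw [h1, ← LinearMap.comp_assoc, ih, LinearMap.comp_assoc, hT, ← LinearMap.comp_assoc,
      ← LinearMap.rTensor_comp]

lemma toLinearMap_pow (T : H →ₐ[𝕜] H) (j : ℕ) :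
    (T ^ j).toLinearMap = (T.toLinearMap : Module.End 𝕜 H) ^ j := by
  induction j with
  | zero => rfl
  | succ j ih => rw [pow_succ, pow_succ, ← ih]; rfl

/-- The order of a comodule algebra automorphism of prime order divides the dimension. -/
lemma dvd_finrank_of_comul_comp [IsAlgClosed 𝕜] [CharZero 𝕜] [FiniteDimensional 𝕜 H] {l : ℕ}
    (hl : l.Prime) {T : H →ₐ[𝕜] H}
    (hT : comul ∘ₗ T.toLinearMap = T.toLinearMap.rTensor H ∘ₗ comul (R := 𝕜))
    (hTl : T ^ l = 1) (hT1 : T ≠ 1) : l ∣ Module.finrank 𝕜 H := by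
  refine dvd_finrank_of_trace_mul_trace hl (T := T.toLinearMap) ?_ ?_ fun j ↦ ?_
  · rw [← toLinearMap_pow, hTl]; rfl
  · intro h
    exact hT1 (AlgHom.toLinearMap_injective h)
  · rw [← toLinearMap_pow]
    exact trace_mul_trace_of_comul_comp _ (comul_pow_toLinearMap hT j)

lemma exists_pow_eq_one_of_isGroupLikeElem [FiniteDimensional 𝕜 H] {g : H}
    (hg : IsGroupLikeElem 𝕜 g) : ∃ m, 0 < m ∧ g ^ m = 1 := by
  let G : GroupLike 𝕜 H := ⟨g, hg⟩
  have : Finite (GroupLike 𝕜 H) := (linearIndep_groupLikeVal (R := 𝕜) (A := H)).finite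
  obtain ⟨m, hm, h⟩ := (isOfFinOrder_of_finite G).exists_pow_eq_one
  exact ⟨m, hm, congrArg GroupLike.val h⟩

/-- Obtained by applying ε ⊗ id to the hypothesis. A comodule endomorphism is thus determined by the
functional ε ∘ T, a character when T is an algebra map. -/
lemma eq_hitLeft_of_comul_comp {T : H →ₗ[𝕜] H}
    (hT : comul ∘ₗ T = T.rTensor H ∘ₗ comul (R := 𝕜)) : T = hitLeft (counit ∘ₗ T) := by
  ext x
  have h := LinearMap.congr_fun hT x
  simp only [LinearMap.comp_apply] at h
  conv_lhs => rw [← hitLeft_counit (𝕜 := 𝕜) (T x)]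
  rw [hitLeft, LinearMap.comp_apply, LinearMap.comp_apply, h, hitLeft, LinearMap.comp_apply,
    LinearMap.comp_apply, LinearMap.rTensor_comp_apply]

lemma eq_hitRight_of_comul_comp {T : H →ₗ[𝕜] H}
    (hT : comul ∘ₗ T = T.lTensor H ∘ₗ comul (R := 𝕜)) : T = hitRight (counit ∘ₗ T) := by
  ext x
  have h := LinearMap.congr_fun hT x
  simp only [LinearMap.comp_apply] at h
  conv_lhs => rw [← hitRight_counit (𝕜 := 𝕜) (T x)]
  rw [hitRight, LinearMap.comp_apply, LinearMap.comp_apply, h, hitRight, LinearMap.comp_apply,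
    LinearMap.comp_apply, LinearMap.lTensor_comp_apply]

/-- The powers of T correspond to the characters ε ∘ T^j. Distinct characters are linearly
independent, so two powers coincide in finite dimension. -/
lemma exists_pow_eq_one_of_comul_comp [FiniteDimensional 𝕜 H] {T : H →ₐ[𝕜] H}
    (hT : comul ∘ₗ T.toLinearMap = T.toLinearMap.rTensor H ∘ₗ comul (R := 𝕜))
    (hinj : Function.Injective T) : ∃ m, 0 < m ∧ T ^ m = 1 := by
  let χ (j : ℕ) : H →ₐ[𝕜] 𝕜 := (Bialgebra.counitAlgHom 𝕜 H).comp (T ^ j)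
  obtain ⟨i, j, hij, hχ⟩ : ∃ i j, i < j ∧ χ i = χ j := by
    by_contra! hcon
    have hχinj : Function.Injective (fun j ↦ (χ j : H →* 𝕜)) := by
      intro i j hij
      have hij' : χ i = χ j := AlgHom.ext fun x ↦ DFunLike.congr_fun hij x
      rcases lt_trichotomy i j with h | h | h
      · exact (hcon i j h hij').elim
      · exact h
      · exact (hcon j i h hij'.symm).elim
    have hli := (linearIndependent_monoidHom H 𝕜).comp _ hχinj
    have hli' : LinearIndependent 𝕜 (fun j ↦ (χ j).toLinearMap) := by
      rw [linearIndependent_iff'] at hli ⊢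
      intro s c hc
      refine hli s c (funext fun x ↦ ?_)
      simpa using LinearMap.congr_fun hc x
    have := hli'.finite
    exact not_finite ℕ
  have hTT : T ^ i = T ^ j := by
    apply AlgHom.toLinearMap_injective
    rw [eq_hitLeft_of_comul_comp (comul_pow_toLinearMap hT i),
      eq_hitLeft_of_comul_comp (comul_pow_toLinearMap hT j)]
    congr 1
    exact LinearMap.ext fun x ↦ DFunLike.congr_fun hχ x
  refine ⟨j - i, Nat.sub_pos_of_lt hij, AlgHom.ext fun x ↦ ?_⟩
  have hinj' : Function.Injective (T ^ i) := by
    rw [AlgHom.coe_pow]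
    exact hinj.iterate i
  apply hinj'
  rw [← AlgHom.mul_apply, ← pow_add, Nat.add_sub_cancel' hij.le, ← hTT]
  rfl

end Orders
end HopfAlgebra

/-! ### The maximal ratio dim(AU) / dim U over a semisimple subalgebra -/

section SpanRatio

lemma Submodule.exists_disjoint_sup_eq {R M : Type*} [Ring R] [AddCommGroup M] [Module R M]
    [IsSemisimpleModule R M] {U V : Submodule R M} (h : U ≤ V) :
    ∃ U' : Submodule R M, Disjoint U U' ∧ U ⊔ U' = V := by
  obtain ⟨W, hW⟩ := ComplementedLattice.exists_isCompl U
  refine ⟨W ⊓ V, hW.disjoint.mono_right inf_le_left, ?_⟩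
  rw [← sup_inf_assoc_of_le W h, hW.sup_eq_top, top_inf_eq]

variable {𝕜 A : Type*} [Field 𝕜] [Ring A] [Algebra 𝕜 A] (K : Subalgebra 𝕜 A)
variable {M : Type*} [AddCommGroup M] [Module 𝕜 M] [Module A M] [IsScalarTower 𝕜 A M]

lemma Submodule.finrank_sup_eq_of_disjoint {B : Type*} [Ring B] [Algebra 𝕜 B]
    [Module B M] [IsScalarTower 𝕜 B M] [FiniteDimensional 𝕜 M] {U V : Submodule B M}
    (h : Disjoint U V) :
    Module.finrank 𝕜 ↥(U ⊔ V) = Module.finrank 𝕜 U + Module.finrank 𝕜 V := by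
  have h1 := Submodule.finrank_sup_add_finrank_inf_eq (U.restrictScalars 𝕜) (V.restrictScalars 𝕜)
  rw [← Submodule.restrictScalars_sup, ← Submodule.restrictScalars_inf, h.eq_bot,
    Submodule.restrictScalars_bot, finrank_bot, add_zero] at h1
  exact h1

lemma Submodule.finrank_sup_le {B : Type*} [Ring B] [Algebra 𝕜 B]
    [Module B M] [IsScalarTower 𝕜 B M] [FiniteDimensional 𝕜 M] (U V : Submodule B M) :
    Module.finrank 𝕜 ↥(U ⊔ V) ≤ Module.finrank 𝕜 U + Module.finrank 𝕜 V := by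
  have h1 := Submodule.finrank_add_le_finrank_add_finrank (U.restrictScalars 𝕜)
    (V.restrictScalars 𝕜)
  rw [← Submodule.restrictScalars_sup] at h1
  exact h1

lemma Submodule.finrank_mono' {B : Type*} [Ring B] [Algebra 𝕜 B]
    [Module B M] [IsScalarTower 𝕜 B M] [FiniteDimensional 𝕜 M] {U V : Submodule B M} (h : U ≤ V) :
    Module.finrank 𝕜 U ≤ Module.finrank 𝕜 V :=
  Submodule.finrank_mono (s := U.restrictScalars 𝕜) (t := V.restrictScalars 𝕜) h

lemma Submodule.finrank_map_le' {B N : Type*} [Ring B] [Algebra 𝕜 B] [AddCommGroup N] [Module 𝕜 N]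
    [Module B N] [IsScalarTower 𝕜 B N] [FiniteDimensional 𝕜 N]
    [Module B M] [IsScalarTower 𝕜 B M] [FiniteDimensional 𝕜 M] (φ : M →ₗ[B] N)
    (U : Submodule B M) : Module.finrank 𝕜 (U.map φ) ≤ Module.finrank 𝕜 U := by
  have h := Submodule.finrank_map_le (φ.restrictScalars 𝕜) (U.restrictScalars 𝕜)
  exact h

/-- The ratio `dim (A U) / dim U`, for `U` a nonzero `K`-submodule of `A`, has a maximum. -/
lemma Subalgebra.exists_finrank_span_ratio_max [Nontrivial A] [FiniteDimensional 𝕜 A] :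
    ∃ I : Submodule K A, I ≠ ⊥ ∧ ∀ J : Submodule K A,
      Module.finrank 𝕜 (Submodule.span A (J : Set A)) * Module.finrank 𝕜 I ≤
        Module.finrank 𝕜 (Submodule.span A (I : Set A)) * Module.finrank 𝕜 J := by
  let F : {I : Submodule K A // I ≠ ⊥} → ℕ × ℕ := fun I ↦
    (Module.finrank 𝕜 (Submodule.span A (I.1 : Set A)), Module.finrank 𝕜 I.1)
  have hpos (I : Submodule K A) (hI : I ≠ ⊥) : 0 < Module.finrank 𝕜 I := by
    have : Nontrivial (I.restrictScalars 𝕜) :=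
      Submodule.nontrivial_iff_ne_bot.2 (by simpa using hI)
    exact Module.finrank_pos (R := 𝕜) (M := I.restrictScalars 𝕜)
  have hle (I : Submodule 𝕜 A) : Module.finrank 𝕜 I ≤ Module.finrank 𝕜 A := I.finrank_le
  have hfin : (Set.range F).Finite := by
    refine (Set.finite_Iic ((Module.finrank 𝕜 A, Module.finrank 𝕜 A) : ℕ × ℕ)).subset ?_
    rintro _ ⟨I, rfl⟩
    exact ⟨hle ((Submodule.span A (I.1 : Set A)).restrictScalars 𝕜), hle (I.1.restrictScalars 𝕜)⟩
  have hne : (Set.range F).Nonempty := ⟨_, ⟨⟨⊤, top_ne_bot⟩, rfl⟩⟩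
  obtain ⟨_, ⟨I, rfl⟩, hI⟩ := Set.exists_max_image _ (fun x : ℕ × ℕ ↦ (x.1 : ℚ) / x.2) hfin hne
  refine ⟨I.1, I.2, fun J ↦ ?_⟩
  by_cases hJ : J = ⊥
  · subst hJ
    have : Submodule.span A ((⊥ : Submodule K A) : Set A) = ⊥ := by simp
    rw [this]
    have h0 : Module.finrank 𝕜 (⊥ : Submodule A A) = 0 := _root_.finrank_bot 𝕜 A
    rw [h0, zero_mul]
    exact Nat.zero_le _
  · have h := hI _ ⟨⟨J, hJ⟩, rfl⟩
    have h1 : (0 : ℚ) < Module.finrank 𝕜 J := by exact_mod_cast hpos J hJ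
    have h2 : (0 : ℚ) < Module.finrank 𝕜 I.1 := by exact_mod_cast hpos I.1 I.2
    simp only [F] at h
    rw [div_le_div_iff₀ h1 h2] at h
    exact_mod_cast h

/-- The maximal ratio for submodules of `A` bounds the ratio in every `A`-module. -/
lemma Subalgebra.finrank_span_mul_le [IsSemisimpleRing K] [FiniteDimensional 𝕜 A]
    [FiniteDimensional 𝕜 M] {I : Submodule K A}
    (hI : ∀ J : Submodule K A,
      Module.finrank 𝕜 (Submodule.span A (J : Set A)) * Module.finrank 𝕜 I ≤
        Module.finrank 𝕜 (Submodule.span A (I : Set A)) * Module.finrank 𝕜 J)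
    (U : Submodule K M) :
    Module.finrank 𝕜 (Submodule.span A (U : Set M)) * Module.finrank 𝕜 I ≤
      Module.finrank 𝕜 (Submodule.span A (I : Set A)) * Module.finrank 𝕜 U := by
  induction h : Module.finrank 𝕜 U using Nat.strong_induction_on generalizing U with
  | _ m ih =>
  by_cases hU : U = ⊥
  · subst hU
    have : Submodule.span A ((⊥ : Submodule K M) : Set M) = ⊥ := by simp
    rw [this]
    have h0 : Module.finrank 𝕜 (⊥ : Submodule A M) = 0 := _root_.finrank_bot 𝕜 M
    rw [h0, zero_mul]
    exact Nat.zero_le _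
  obtain ⟨u, huU, hu0⟩ := Submodule.exists_mem_ne_zero_of_ne_bot hU
  let f : K →ₗ[K] M := LinearMap.toSpanSingleton K M u
  let φ : A →ₗ[A] M := LinearMap.toSpanSingleton A M u
  -- By semisimplicity the cyclic module Ku is isomorphic to a left ideal J' of K, hence to a
  -- K-submodule J of A, where the bound `hI` applies. Induction handles a complement of Ku in U.
  obtain ⟨J', hJ'⟩ := exists_isCompl (LinearMap.ker f)
  let j : K →ₗ[K] A := LinearMap.toSpanSingleton K A 1
  have hj (k : K) : j k = k := by simp [j, Subalgebra.smul_def]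
  have hjinj : Function.Injective j := fun a b hab ↦ Subtype.ext (by rwa [hj, hj] at hab)
  let J : Submodule K A := J'.map j
  let C : Submodule K M := LinearMap.range f
  have hCU : C ≤ U := by
    rintro _ ⟨k, rfl⟩
    exact U.smul_mem k huU
  have hC1 : Module.finrank 𝕜 C = Module.finrank 𝕜 J :=
    (((LinearMap.kerComplementEquivRange f hJ'.symm).restrictScalars 𝕜).symm.finrank_eq).trans
    (((Submodule.equivMapOfInjective j hjinj J').restrictScalars 𝕜).finrank_eq)
  have hC2 : Module.finrank 𝕜 (Submodule.span A (C : Set M)) ≤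
      Module.finrank 𝕜 (Submodule.span A (J : Set A)) := by
    refine le_trans (Submodule.finrank_mono' (𝕜 := 𝕜) ?_)
      (Submodule.finrank_map_le' (𝕜 := 𝕜) φ (Submodule.span A (J : Set A)))
    rw [Submodule.span_le]
    rintro _ ⟨k, rfl⟩
    obtain ⟨a, ha, b, hb, rfl⟩ := Submodule.mem_sup.1
      (hJ'.sup_eq_top ▸ Submodule.mem_top : k ∈ LinearMap.ker f ⊔ J')
    refine ⟨(b : A), Submodule.subset_span ⟨b, hb, hj b⟩, ?_⟩
    rw [map_add, LinearMap.mem_ker.1 ha, zero_add]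
    rfl
  obtain ⟨U', hd, rfl⟩ := Submodule.exists_disjoint_sup_eq hCU
  have hC0 : 0 < Module.finrank 𝕜 C := by
    have : Nontrivial (C.restrictScalars 𝕜) := by
      refine Submodule.nontrivial_iff_ne_bot.2 fun h0 ↦ hu0 ?_
      have : u ∈ C.restrictScalars 𝕜 := ⟨1, one_smul _ u⟩
      rw [h0] at this
      exact (Submodule.mem_bot 𝕜).1 this
    exact Module.finrank_pos (R := 𝕜) (M := C.restrictScalars 𝕜)
  rw [Submodule.finrank_sup_eq_of_disjoint hd] at h
  have hspan : Submodule.span A ((C ⊔ U' : Submodule K M) : Set M) ≤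
      Submodule.span A (C : Set M) ⊔ Submodule.span A (U' : Set M) := by
    rw [Submodule.span_le]
    intro x hx
    obtain ⟨a, ha, b, hb, rfl⟩ := Submodule.mem_sup.1 hx
    exact Submodule.add_mem_sup (Submodule.subset_span ha) (Submodule.subset_span hb)
  have h1 := (Submodule.finrank_mono' (𝕜 := 𝕜) hspan).trans (Submodule.finrank_sup_le _ _)
  have h2 := ih _ (by omega) U' rfl
  have h3 := hI J
  rw [← h, mul_add, hC1]
  calc _ ≤ (Module.finrank 𝕜 (Submodule.span A (J : Set A)) +
        Module.finrank 𝕜 (Submodule.span A (U' : Set M))) * Module.finrank 𝕜 I :=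
        Nat.mul_le_mul_right _ (h1.trans (Nat.add_le_add_right hC2 _))
    _ ≤ _ := by rw [add_mul]; exact Nat.add_le_add h3 h2

end SpanRatio

namespace HopfAlgebra

open Coalgebra

/-! ### The dimension formula dim H = dim(He) · dim K -/

section Freeness

/-- The tensor square of a bialgebra, with the diagonal action. -/
def DiagTensor (𝕜 H : Type*) [Field 𝕜] [Ring H] [HopfAlgebra 𝕜 H] : Type _ := H ⊗[𝕜] H

variable {𝕜 H : Type*} [Field 𝕜] [Ring H] [HopfAlgebra 𝕜 H]

noncomputable instance : AddCommGroup (DiagTensor 𝕜 H) := inferInstanceAs (AddCommGroup (H ⊗[𝕜] H))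

noncomputable instance : Module 𝕜 (DiagTensor 𝕜 H) := inferInstanceAs (Module 𝕜 (H ⊗[𝕜] H))

noncomputable instance : Module H (DiagTensor 𝕜 H) where
  smul h t := Mul.mul (α := H ⊗[𝕜] H) (comul (R := 𝕜) h) t
  one_smul t := (congrArg (fun s ↦ Mul.mul (α := H ⊗[𝕜] H) s t) Bialgebra.comul_one).trans
    (one_mul (M := H ⊗[𝕜] H) t)
  mul_smul a b t := (congrArg (fun s ↦ Mul.mul (α := H ⊗[𝕜] H) s t)
    (Bialgebra.comul_mul a b)).trans (mul_assoc (G := H ⊗[𝕜] H) _ _ _)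
  smul_zero _ := mul_zero (M₀ := H ⊗[𝕜] H) _
  smul_add _ _ _ := mul_add (R := H ⊗[𝕜] H) _ _ _
  add_smul a b t := (congrArg (fun s ↦ Mul.mul (α := H ⊗[𝕜] H) s t) (map_add comul a b)).trans
    (add_mul (R := H ⊗[𝕜] H) _ _ _)
  zero_smul t := (congrArg (fun s ↦ Mul.mul (α := H ⊗[𝕜] H) s t) (map_zero comul)).trans
    (zero_mul (M₀ := H ⊗[𝕜] H) t)

instance : IsScalarTower 𝕜 H (DiagTensor 𝕜 H) where
  smul_assoc c h t := (congrArg (fun s ↦ Mul.mul (α := H ⊗[𝕜] H) s t) (map_smul comul c h)).trans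
    (smul_mul_assoc (β := H ⊗[𝕜] H) c _ _)

instance [FiniteDimensional 𝕜 H] : FiniteDimensional 𝕜 (DiagTensor 𝕜 H) :=
  inferInstanceAs (FiniteDimensional 𝕜 (H ⊗[𝕜] H))

lemma tmul_ne_zero {V W : Type*} [AddCommGroup V] [Module 𝕜 V] [AddCommGroup W] [Module 𝕜 W]
    {v : V} {w : W} (hv : v ≠ 0) (hw : w ≠ 0) : v ⊗ₜ[𝕜] w ≠ 0 := by
  intro h
  obtain ⟨f, hf⟩ : ∃ f : V →ₗ[𝕜] 𝕜, f v ≠ 0 := by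
    by_contra! h
    exact hv ((Module.forall_dual_apply_eq_zero_iff 𝕜 v).1 h)
  have h1 := congrArg (TensorProduct.lid 𝕜 W ∘ f.rTensor W) h
  simp [hf, hw] at h1

/-- `h ↦ Δ(h) (y ⊗ 1)` is injective. -/
lemma comul_mul_tmul_one_ne_zero [CharZero 𝕜] [FiniteDimensional 𝕜 H] {y h : H} (hy : y ≠ 0)
    (hh : h ≠ 0) : (comul (R := 𝕜) h * (y ⊗ₜ[𝕜] (1 : H))) ≠ 0 := by
  intro h0
  -- This map a ⊗ b ↦ (S(a) ⊗ 1)Δ(b) sends Δ(h)(y ⊗ 1) to S(y) ⊗ h, which is nonzero since S is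
  -- injective.
  let ω : H ⊗[𝕜] H →ₗ[𝕜] H ⊗[𝕜] H := LinearMap.mul' 𝕜 (H ⊗[𝕜] H) ∘ₗ
    TensorProduct.map ((TensorProduct.mk 𝕜 H H).flip 1 ∘ₗ antipode 𝕜) comul
  have hω (a b : H) : ω (a ⊗ₜ b) = (antipode 𝕜 a ⊗ₜ 1) * comul b := rfl
  have h1 : ω (comul (R := 𝕜) h * (y ⊗ₜ[𝕜] (1 : H))) = antipode 𝕜 y ⊗ₜ h := by
    have h2 := congrArg ((antipode 𝕜 y ⊗ₜ[𝕜] (1 : H)) * ·) (sum_antipode_mul_comul (𝕜 := 𝕜) h)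
    simp only [Finset.mul_sum, ← mul_assoc, Algebra.TensorProduct.tmul_mul_tmul, one_mul,
      mul_one, ← antipode_mul_antidistrib] at h2
    rw [comul_eq_sum, Finset.sum_mul, map_sum, ← h2]
    simp [hω]
  rw [h0, map_zero] at h1
  refine tmul_ne_zero ?_ hh h1.symm
  intro h3
  exact hy (antipode_bijective.1 (h3.trans (map_zero _).symm))

/-- A semisimple Hopf subalgebra `K` with normalized integral `e` satisfies
`dim H = dim (H e) * dim K`. -/
theorem finrank_eq_finrank_range_mulRight_mul [CharZero 𝕜] [FiniteDimensional 𝕜 H]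
    (K : Subalgebra 𝕜 H) [IsSemisimpleRing K]
    (hK : ∀ x ∈ K, (comul x : H ⊗[𝕜] H) ∈
      LinearMap.range (TensorProduct.mapIncl K.toSubmodule K.toSubmodule))
    {e : H} (heK : e ∈ K) (he : ∀ x ∈ K, x * e = counit (R := 𝕜) x • e)
    (he1 : counit (R := 𝕜) e = 1) :
    Module.finrank 𝕜 H =
      Module.finrank 𝕜 (LinearMap.range (LinearMap.mulRight 𝕜 e)) * Module.finrank 𝕜 K := by
  have : Nontrivial H := Bialgebra.nontrivial (R := 𝕜)
  obtain ⟨I, hI0, hI⟩ := K.exists_finrank_span_ratio_max (𝕜 := 𝕜) (A := H)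
  set D := Module.finrank 𝕜 I with hD
  set N := Module.finrank 𝕜 (Submodule.span H (I : Set H)) with hN
  obtain ⟨y, hyI, hy0⟩ := Submodule.exists_mem_ne_zero_of_ne_bot hI0
  have hDpos : 0 < D := by
    have : Nontrivial (I.restrictScalars 𝕜) :=
      Submodule.nontrivial_iff_ne_bot.2 (by simpa using hI0)
    exact Module.finrank_pos (R := 𝕜) (M := I.restrictScalars 𝕜)
  let M := DiagTensor 𝕜 H
  -- Z = I ⊗ H with diagonal action. It is K-stable because Δ(K) ⊆ K ⊗ K, and its H-span contains HI
  -- ⊗ H, so Z attains the maximal ratio N / D.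
  let Z₀ : Submodule 𝕜 (H ⊗[𝕜] H) :=
    LinearMap.range ((I.restrictScalars 𝕜).subtype.rTensor H)
  have hZ₀ (i : H) (hi : i ∈ I) (h : H) : i ⊗ₜ[𝕜] h ∈ Z₀ := ⟨⟨i, hi⟩ ⊗ₜ h, rfl⟩
  have hmul (s : K.toSubmodule ⊗[𝕜] K.toSubmodule) (t : I.restrictScalars 𝕜 ⊗[𝕜] H) :
      TensorProduct.mapIncl K.toSubmodule K.toSubmodule s *
        (I.restrictScalars 𝕜).subtype.rTensor H t ∈ Z₀ := by
    induction s with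
    | zero => simp
    | add a b ha hb => rw [map_add, add_mul]; exact Z₀.add_mem ha hb
    | tmul a b =>
      induction t with
      | zero => simp
      | add u v hu hv => rw [map_add, mul_add]; exact Z₀.add_mem hu hv
      | tmul i h =>
        rw [TensorProduct.mapIncl, TensorProduct.map_tmul, LinearMap.rTensor_tmul,
          Algebra.TensorProduct.tmul_mul_tmul]
        exact hZ₀ _ (I.smul_mem (⟨a, a.2⟩ : K) i.2) _
  let Z : Submodule K M :=
    { Z₀ with
      smul_mem' := by
        rintro ⟨k, hk⟩ _ ⟨t, rfl⟩
        change (comul (R := 𝕜) k * _ : H ⊗[𝕜] H) ∈ Z₀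
        obtain ⟨s, hs⟩ := hK k hk
        rw [← hs]
        exact hmul s t }
  have hZrank : Module.finrank 𝕜 Z = D * Module.finrank 𝕜 H := by
    have hinj : Function.Injective ((I.restrictScalars 𝕜).subtype.rTensor H) :=
      Module.Flat.rTensor_preserves_injective_linearMap _ (Submodule.subtype_injective _)
    have h1 := LinearMap.finrank_range_of_inj hinj
    rw [Module.finrank_tensorProduct] at h1
    exact h1
  have hHZ : N * Module.finrank 𝕜 H ≤ Module.finrank 𝕜 (Submodule.span H (Z : Set M)) := by
    let P := (Submodule.span H (I : Set H)).restrictScalars 𝕜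
    have hinj : Function.Injective (P.subtype.rTensor H) :=
      Module.Flat.rTensor_preserves_injective_linearMap _ (Submodule.subtype_injective _)
    have h1 := LinearMap.finrank_range_of_inj hinj
    rw [Module.finrank_tensorProduct] at h1
    rw [show N = Module.finrank 𝕜 P from rfl, ← h1]
    let HZ : Submodule 𝕜 (H ⊗[𝕜] H) := (Submodule.span H (Z : Set M)).restrictScalars 𝕜
    refine Submodule.finrank_mono (s := LinearMap.range (P.subtype.rTensor H))
      (t := HZ) ?_
    rintro _ ⟨t, rfl⟩
    induction t with
    | zero => rw [map_zero]; exact Submodule.zero_mem _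
    | add a b ha hb => rw [map_add]; exact Submodule.add_mem _ ha hb
    | tmul x a =>
      obtain ⟨x, hx⟩ := x
      change x ⊗ₜ[𝕜] a ∈ HZ
      have hx' : x ∈ Submodule.span H (I : Set H) := hx
      clear hx
      induction hx' using Submodule.span_induction generalizing a with
      | mem x hx => exact Submodule.subset_span (R := H) (M := M) (s := (Z : Set M)) (hZ₀ x hx a)
      | zero => rw [TensorProduct.zero_tmul]; exact Submodule.zero_mem _
      | add u v _ _ hu hv => rw [TensorProduct.add_tmul]; exact Submodule.add_mem _ (hu a) (hv a)
      | smul r u _ hu =>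
        have h2 := congrArg (· * (u ⊗ₜ[𝕜] a)) (sum_comul_mul_antipode (𝕜 := 𝕜) r)
        simp only [Finset.sum_mul, mul_assoc, Algebra.TensorProduct.tmul_mul_tmul, one_mul] at h2
        rw [smul_eq_mul, ← h2]
        exact Submodule.sum_mem _ fun i _ ↦
          Submodule.smul_mem (Submodule.span H (Z : Set M)) _ (hu _)
  -- A submodule of a maximizer is a maximizer: a complement of U in Z cannot exceed the ratio, so U
  -- cannot fall below it.
  have key (U : Submodule K M) (hU : U ≤ Z) :
      N * Module.finrank 𝕜 U ≤ Module.finrank 𝕜 (Submodule.span H (U : Set M)) * D := by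
    obtain ⟨U', hd, hUU'⟩ := Submodule.exists_disjoint_sup_eq hU
    have h1 := Submodule.finrank_sup_eq_of_disjoint (𝕜 := 𝕜) hd
    rw [hUU', hZrank] at h1
    have hspan : Submodule.span H (Z : Set M) ≤
        Submodule.span H (U : Set M) ⊔ Submodule.span H (U' : Set M) := by
      rw [← hUU', Submodule.span_le]
      intro x hx
      obtain ⟨a, ha, b, hb, rfl⟩ := Submodule.mem_sup.1 hx
      exact Submodule.add_mem_sup (Submodule.subset_span ha) (Submodule.subset_span hb)
    have h2 := hHZ.trans ((Submodule.finrank_mono' (𝕜 := 𝕜) hspan).trans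
      (Submodule.finrank_sup_le _ _))
    have h3 := K.finrank_span_mul_le (𝕜 := 𝕜) hI U'
    rw [← hD, ← hN] at h3
    have h4 := Nat.mul_le_mul_right D h2
    rw [mul_assoc, mul_comm (Module.finrank 𝕜 H) D] at h4
    rw [h1, mul_add, add_mul] at h4
    omega
  let φ : H →ₗ[H] M := LinearMap.toSpanSingleton H M (y ⊗ₜ[𝕜] (1 : H) : H ⊗[𝕜] H)
  have hφ (h : H) : φ h = (comul (R := 𝕜) h * (y ⊗ₜ[𝕜] (1 : H)) : H ⊗[𝕜] H) := rfl
  have hφinj : Function.Injective φ := (injective_iff_map_eq_zero φ).2 fun h hh ↦ by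
    by_contra h0
    exact comul_mul_tmul_one_ne_zero hy0 h0 hh
  let φK : K →ₗ[K] M := LinearMap.toSpanSingleton K M (y ⊗ₜ[𝕜] (1 : H) : H ⊗[𝕜] H)
  have hφK (k : K) : φK k = φ k := rfl
  have hφKZ (k : K) : φK k ∈ Z := Z.smul_mem k (hZ₀ y hyI 1)
  -- U = K(y ⊗ 1) is a copy of K and its H-span has dimension at most dim H. The reverse bound `e2`
  -- tests maximality on K itself, so N / D = dim H / dim K.
  have e1 : N * Module.finrank 𝕜 K ≤ Module.finrank 𝕜 H * D := by
    have hU := key (LinearMap.range φK) (by rintro _ ⟨k, rfl⟩; exact hφKZ k)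
    have h1 : Module.finrank 𝕜 (LinearMap.range φK) = Module.finrank 𝕜 K :=
      LinearMap.finrank_range_of_inj (f := φK.restrictScalars 𝕜)
        (fun a b hab ↦ Subtype.ext (hφinj hab))
    have h2 : Module.finrank 𝕜 (Submodule.span H (LinearMap.range φK : Set M)) ≤
        Module.finrank 𝕜 H := by
      refine (Submodule.finrank_mono' (𝕜 := 𝕜) (V := LinearMap.range φ) ?_).trans
        (LinearMap.finrank_range_le (φ.restrictScalars 𝕜))
      rw [Submodule.span_le]
      rintro _ ⟨k, rfl⟩
      exact ⟨k, rfl⟩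
    rw [h1] at hU
    exact hU.trans (Nat.mul_le_mul_right D h2)
  have e2 : Module.finrank 𝕜 H * D ≤ N * Module.finrank 𝕜 K := by
    have h := hI (LinearMap.range (LinearMap.toSpanSingleton K H 1))
    have h1 : Module.finrank 𝕜 (LinearMap.range (LinearMap.toSpanSingleton K H 1)) ≤
      Module.finrank 𝕜 K :=
      LinearMap.finrank_range_le ((LinearMap.toSpanSingleton K H 1).restrictScalars 𝕜)
    have h2 : Submodule.span H (LinearMap.range (LinearMap.toSpanSingleton K H 1) : Set H) = ⊤ :=
      (Ideal.eq_top_iff_one _).2 (Submodule.subset_span ⟨1, one_smul _ _⟩)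
    rw [h2] at h
    have h3 : Module.finrank 𝕜 (⊤ : Submodule H H) = Module.finrank 𝕜 H := finrank_top 𝕜 H
    rw [h3] at h
    exact h.trans (Nat.mul_le_mul_left N h1)
  let R := LinearMap.range (LinearMap.mulRight 𝕜 e)
  have hR : Submodule.span H {e} = LinearMap.range (LinearMap.toSpanSingleton H H e) :=
    (LinearMap.range_toSpanSingleton e).symm
  have hRrank : Module.finrank 𝕜 (Submodule.span H {e}) = Module.finrank 𝕜 R := by
    rw [hR]; rfl
  have he0 : e ≠ 0 := fun h ↦ by simp [h] at he1
  -- Here U is spanned by the image of e and its H-span lies in a copy of He; `e4` tests maximality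
  -- on the line 𝕜e = Ke. Hence also N / D = dim He.
  have e3 : N ≤ Module.finrank 𝕜 R * D := by
    let U : Submodule K M := Submodule.span K {φ e}
    have hU := key U (by
      rw [Submodule.span_singleton_le_iff_mem]
      exact hφKZ ⟨e, heK⟩)
    have h1 : 1 ≤ Module.finrank 𝕜 U := by
      have : Nontrivial (U.restrictScalars 𝕜) := by
        refine Submodule.nontrivial_iff_ne_bot.2 fun h0 ↦ he0 ?_
        have : φ e ∈ U.restrictScalars 𝕜 := Submodule.mem_span_singleton_self _
        rw [h0] at this
        exact hφinj (((Submodule.mem_bot 𝕜).1 this).trans (map_zero φ).symm)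
      exact Module.finrank_pos (R := 𝕜) (M := U.restrictScalars 𝕜)
    have h2 : Module.finrank 𝕜 (Submodule.span H (U : Set M)) ≤ Module.finrank 𝕜 R := by
      rw [← hRrank]
      refine (Submodule.finrank_mono' (𝕜 := 𝕜) ?_).trans
        (Submodule.finrank_map_le' (𝕜 := 𝕜) φ _)
      rw [Submodule.span_le]
      intro x hx
      obtain ⟨k, rfl⟩ := Submodule.mem_span_singleton.1 hx
      refine ⟨(k : H) • e, Submodule.smul_mem _ _ (Submodule.mem_span_singleton_self e), ?_⟩
      rw [map_smul]
      rfl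
    calc N = N * 1 := (mul_one N).symm
      _ ≤ N * Module.finrank 𝕜 U := Nat.mul_le_mul_left N h1
      _ ≤ _ := hU.trans (Nat.mul_le_mul_right D h2)
  have e4 : Module.finrank 𝕜 R * D ≤ N := by
    have h := hI (Submodule.span K {e})
    have h1 : Module.finrank 𝕜 (Submodule.span K {e}) ≤ 1 := by
      have hle : (Submodule.span K {e}).restrictScalars 𝕜 ≤ Submodule.span 𝕜 {e} := by
        intro x hx
        obtain ⟨k, rfl⟩ := Submodule.mem_span_singleton.1 hx
        exact Submodule.mem_span_singleton.2 ⟨counit (R := 𝕜) (k : H), (he k k.2).symm⟩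
      refine (Submodule.finrank_mono hle).trans ?_
      exact (finrank_span_le_card ({e} : Set H)).trans (by simp)
    have h2 : Submodule.span H {e} ≤ Submodule.span H (Submodule.span K {e} : Set H) :=
      Submodule.span_mono (Set.singleton_subset_iff.2 (Submodule.mem_span_singleton_self e))
    have h3 := Submodule.finrank_mono' (𝕜 := 𝕜) h2
    rw [hRrank] at h3
    calc _ ≤ _ := Nat.mul_le_mul_right D h3
      _ ≤ _ := h
      _ ≤ N * 1 := Nat.mul_le_mul_left N h1
      _ = N := mul_one N
  have e5 : N = Module.finrank 𝕜 R * D := le_antisymm e3 e4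
  have e6 : Module.finrank 𝕜 H * D = N * Module.finrank 𝕜 K := le_antisymm e2 e1
  rw [e5] at e6
  refine Nat.eq_of_mul_eq_mul_right hDpos (e6.trans ?_)
  ring

end Freeness
end HopfAlgebra

/-! ### Hopf subalgebras as Hopf algebras -/

namespace IsHopfSubalgebra

open Coalgebra HopfAlgebra

variable {𝕜 H : Type*} [Field 𝕜] [Ring H] [HopfAlgebra 𝕜 H] {K : Subalgebra 𝕜 H}

lemma map_val_injective (K : Subalgebra 𝕜 H) :
    Function.Injective (Algebra.TensorProduct.map K.val K.val) := by
  change Function.Injective (TensorProduct.map K.val.toLinearMap K.val.toLinearMap)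
  exact TensorProduct.map_injective_of_flat_flat _ _ Subtype.val_injective Subtype.val_injective

/-- The comultiplication of a Hopf subalgebra. -/
noncomputable def comulAlgHom (hK : IsHopfSubalgebra K) : K →ₐ[𝕜] K ⊗[𝕜] K :=
  (AlgEquiv.ofInjective _ (map_val_injective K)).symm.toAlgHom.comp
    (((Bialgebra.comulAlgHom 𝕜 H).comp K.val).codRestrict
      (Algebra.TensorProduct.map K.val K.val).range fun x ↦ by
        obtain ⟨t, ht⟩ := hK.comul_mem x x.2
        exact ⟨t, ht⟩)

lemma map_comulAlgHom (hK : IsHopfSubalgebra K) (x : K) :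
    Algebra.TensorProduct.map K.val K.val (hK.comulAlgHom x) = comul (R := 𝕜) (x : H) := by
  have h := (AlgEquiv.ofInjective _ (map_val_injective K)).apply_symm_apply
    ((((Bialgebra.comulAlgHom 𝕜 H).comp K.val).codRestrict
      (Algebra.TensorProduct.map K.val K.val).range fun x ↦ by
        obtain ⟨t, ht⟩ := hK.comul_mem x x.2
        exact ⟨t, ht⟩) x)
  exact congrArg Subtype.val h

/-- A Hopf subalgebra is a bialgebra. -/
noncomputable abbrev bialgebra (hK : IsHopfSubalgebra K) : Bialgebra 𝕜 K :=
  Bialgebra.ofAlgHom hK.comulAlgHom ((Bialgebra.counitAlgHom 𝕜 H).comp K.val)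
    (by
      -- Each coalgebra axiom is checked in H, through the injection of tensor powers of K into
      -- those of H.
      have hinj : Function.Injective (Algebra.TensorProduct.map K.val
          (Algebra.TensorProduct.map K.val K.val)) :=
        TensorProduct.map_injective_of_flat_flat K.val.toLinearMap
          (Algebra.TensorProduct.map K.val K.val).toLinearMap Subtype.val_injective
          (map_val_injective K)
      have h1 (t : K ⊗[𝕜] K) : Algebra.TensorProduct.map K.val
          (Algebra.TensorProduct.map K.val K.val) (Algebra.TensorProduct.assoc 𝕜 𝕜 𝕜 K K K
          (Algebra.TensorProduct.map hK.comulAlgHom (.id 𝕜 K) t)) =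
          TensorProduct.assoc 𝕜 H H H (comul.rTensor H
            (Algebra.TensorProduct.map K.val K.val t)) := by
        induction t with
        | zero => simp
        | add a b ha hb => simp only [map_add, ha, hb]
        | tmul a b =>
          simp only [Algebra.TensorProduct.map_tmul, LinearMap.rTensor_tmul, Subalgebra.coe_val,
            ← hK.map_comulAlgHom, AlgHom.id_apply]
          generalize hK.comulAlgHom a = s
          induction s with
          | zero => simp
          | add u v hu hv => simp only [map_add, TensorProduct.add_tmul, hu, hv]
          | tmul u v => simp
      have h2 (t : K ⊗[𝕜] K) : Algebra.TensorProduct.map K.val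
          (Algebra.TensorProduct.map K.val K.val)
          (Algebra.TensorProduct.map (.id 𝕜 K) hK.comulAlgHom t) =
          comul.lTensor H (Algebra.TensorProduct.map K.val K.val t) := by
        induction t with
        | zero => simp
        | add a b ha hb => simp only [map_add, ha, hb]
        | tmul a b => simp [hK.map_comulAlgHom]
      ext x
      apply hinj
      simp only [AlgHom.comp_apply]
      refine (h1 _).trans (Eq.trans ?_ (h2 _).symm)
      rw [hK.map_comulAlgHom, coassoc_apply])
    (by
      have hinj : Function.Injective (Algebra.TensorProduct.map (.id 𝕜 𝕜) K.val) :=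
        TensorProduct.map_injective_of_flat_flat LinearMap.id K.val.toLinearMap
          Function.injective_id Subtype.val_injective
      have h1 (t : K ⊗[𝕜] K) : Algebra.TensorProduct.map (.id 𝕜 𝕜) K.val
          (Algebra.TensorProduct.map ((Bialgebra.counitAlgHom 𝕜 H).comp K.val) (.id 𝕜 K) t) =
          counit.rTensor H (Algebra.TensorProduct.map K.val K.val t) := by
        induction t with
        | zero => simp
        | add a b ha hb => simp only [map_add, ha, hb]
        | tmul a b => simp
      ext x
      apply hinj
      refine (h1 (hK.comulAlgHom x)).trans ?_
      rw [hK.map_comulAlgHom, rTensor_counit_comul]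
      rfl)
    (by
      have hinj : Function.Injective (Algebra.TensorProduct.map K.val (.id 𝕜 𝕜)) :=
        TensorProduct.map_injective_of_flat_flat K.val.toLinearMap LinearMap.id
          Subtype.val_injective Function.injective_id
      have h1 (t : K ⊗[𝕜] K) : Algebra.TensorProduct.map K.val (.id 𝕜 𝕜)
          (Algebra.TensorProduct.map (.id 𝕜 K) ((Bialgebra.counitAlgHom 𝕜 H).comp K.val) t) =
          counit.lTensor H (Algebra.TensorProduct.map K.val K.val t) := by
        induction t with
        | zero => simp
        | add a b ha hb => simp only [map_add, ha, hb]
        | tmul a b => simp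
      ext x
      apply hinj
      refine (h1 (hK.comulAlgHom x)).trans ?_
      rw [hK.map_comulAlgHom, lTensor_counit_comul]
      rfl)

/-- A Hopf subalgebra is a Hopf algebra. -/
noncomputable abbrev hopfAlgebra (hK : IsHopfSubalgebra K) : HopfAlgebra 𝕜 K :=
  letI := hK.bialgebra
  let S : K →ₗ[𝕜] K := (antipode 𝕜).restrict (p := K.toSubmodule) (q := K.toSubmodule)
    hK.antipode_mem
  { antipode := S
    mul_antipode_rTensor_comul := by
      have h1 (t : K ⊗[𝕜] K) : ((LinearMap.mul' 𝕜 K (S.rTensor K t) : K) : H) =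
          LinearMap.mul' 𝕜 H ((antipode 𝕜).rTensor H
            (Algebra.TensorProduct.map K.val K.val t)) := by
        induction t with
        | zero => simp
        | add a b ha hb => simp only [map_add, Subalgebra.coe_add, ha, hb]
        | tmul a b => rfl
      ext x
      refine (h1 (hK.comulAlgHom x)).trans ?_
      rw [hK.map_comulAlgHom, mul_antipode_rTensor_comul_apply]
      rfl
    mul_antipode_lTensor_comul := by
      have h1 (t : K ⊗[𝕜] K) : ((LinearMap.mul' 𝕜 K (S.lTensor K t) : K) : H) =
          LinearMap.mul' 𝕜 H ((antipode 𝕜).lTensor H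
            (Algebra.TensorProduct.map K.val K.val t)) := by
        induction t with
        | zero => simp
        | add a b ha hb => simp only [map_add, Subalgebra.coe_add, ha, hb]
        | tmul a b => rfl
      ext x
      refine (h1 (hK.comulAlgHom x)).trans ?_
      rw [hK.map_comulAlgHom, mul_antipode_lTensor_comul_apply]
      rfl }

lemma hitLeft_mem (hK : IsHopfSubalgebra K) (f : H →ₗ[𝕜] 𝕜) {x : H} (hx : x ∈ K) :
    hitLeft f x ∈ K := by
  have h := hK.map_comulAlgHom ⟨x, hx⟩
  rw [hitLeft, LinearMap.comp_apply, LinearMap.comp_apply, ← h]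
  generalize hK.comulAlgHom ⟨x, hx⟩ = t
  induction t with
  | zero => simp
  | add a b ha hb => simpa only [map_add] using K.add_mem ha hb
  | tmul a b => simpa using K.smul_mem b.2 _

section

variable [IsAlgClosed 𝕜] [CharZero 𝕜] [FiniteDimensional 𝕜 H]

lemma dvd_finrank_of_isGroupLikeElem (hK : IsHopfSubalgebra K) {l : ℕ} (hl : l.Prime) {g : H}
    (hgK : g ∈ K) (hg : IsGroupLikeElem 𝕜 g) (hgl : g ^ l = 1) (hg1 : g ≠ 1) :
    l ∣ Module.finrank 𝕜 K := by
  let := hK.hopfAlgebra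
  refine HopfAlgebra.dvd_finrank_of_isGroupLikeElem (𝕜 := 𝕜) hl (g := (⟨g, hgK⟩ : K))
    ⟨hg.counit_eq_one, map_val_injective K ?_⟩ (Subtype.ext hgl)
    fun h ↦ hg1 (congrArg Subtype.val h)
  exact (hK.map_comulAlgHom _).trans hg.comul_eq_tmul_self

/-- T is a left hit, and K is stable under left hits, so T restricts to K and the order theorem
applies there. -/
lemma dvd_finrank_of_comul_comp (hK : IsHopfSubalgebra K) {l : ℕ} (hl : l.Prime)
    {T : H →ₐ[𝕜] H} (hT : comul ∘ₗ T.toLinearMap = T.toLinearMap.rTensor H ∘ₗ comul (R := 𝕜))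
    (hTl : T ^ l = 1) (hT1 : ∃ x ∈ K, T x ≠ x) : l ∣ Module.finrank 𝕜 K := by
  let := hK.hopfAlgebra
  have hTK (x : H) (hx : x ∈ K) : T x ∈ K := by
    have := LinearMap.congr_fun (eq_hitLeft_of_comul_comp hT) x
    rw [← AlgHom.toLinearMap_apply, this]
    exact hK.hitLeft_mem _ hx
  let T' : K →ₐ[𝕜] K := (T.comp K.val).codRestrict K fun x ↦ hTK x x.2
  have hT'pow (j : ℕ) (x : K) : ((T' ^ j) x : H) = (T ^ j) x := by
    induction j with
    | zero => rfl
    | succ j ih => rw [pow_succ', pow_succ', AlgHom.mul_apply, AlgHom.mul_apply, ← ih]; rfl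
  refine HopfAlgebra.dvd_finrank_of_comul_comp (𝕜 := 𝕜) hl (T := T') ?_ ?_ ?_
  · ext x
    apply map_val_injective K
    have h1 (t : K ⊗[𝕜] K) : Algebra.TensorProduct.map K.val K.val (T'.toLinearMap.rTensor K t) =
        T.toLinearMap.rTensor H (Algebra.TensorProduct.map K.val K.val t) := by
      induction t with
      | zero => simp
      | add a b ha hb => simp only [map_add, ha, hb]
      | tmul a b => rfl
    refine (hK.map_comulAlgHom (T' x)).trans (Eq.trans ?_ (h1 (hK.comulAlgHom x)).symm)
    rw [hK.map_comulAlgHom]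
    exact LinearMap.congr_fun hT x
  · ext x
    rw [hT'pow, hTl]
    rfl
  · rintro h
    obtain ⟨x, hx, hxT⟩ := hT1
    exact hxT (congrArg Subtype.val (DFunLike.congr_fun h (⟨x, hx⟩ : K)))

end

end IsHopfSubalgebra

/-! ### The normalized integral e of K and the action of S² on He -/

namespace HopfAlgebra

open Coalgebra

variable {𝕜 H : Type*} [Field 𝕜] [Ring H] [HopfAlgebra 𝕜 H]

/-- The kernel of ε on K has a complementary left ideal; e is the component of 1 in it. For x in K,
(x − ε(x))e lies in both summands and so vanishes. -/
lemma exists_integral_of_isSemisimpleRing (K : Subalgebra 𝕜 H) [IsSemisimpleRing K] :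
    ∃ e ∈ K, (∀ x ∈ K, x * e = counit (R := 𝕜) x • e) ∧ counit (R := 𝕜) e = 1 := by
  let ε : K →ₐ[𝕜] 𝕜 := (Bialgebra.counitAlgHom 𝕜 H).comp K.val
  have hε (x : K) : ε x = counit (R := 𝕜) (x : H) := rfl
  obtain ⟨J, hJ⟩ := exists_isCompl (RingHom.ker ε)
  obtain ⟨i, hi, e, he, hie⟩ := Submodule.mem_sup.1
    (hJ.sup_eq_top ▸ Submodule.mem_top : (1 : K) ∈ RingHom.ker ε ⊔ J)
  have hεe : ε e = 1 := by
    have := congrArg ε hie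
    rwa [map_add, (RingHom.mem_ker).1 hi, zero_add, map_one] at this
  refine ⟨e, e.2, fun x hx ↦ ?_, hεe⟩
  have h0 : (⟨x, hx⟩ - algebraMap 𝕜 K (ε ⟨x, hx⟩)) * e = 0 := by
    have h1 : (⟨x, hx⟩ - algebraMap 𝕜 K (ε ⟨x, hx⟩)) * e ∈ RingHom.ker ε := by
      simp [RingHom.mem_ker]
    exact Submodule.disjoint_def.1 hJ.disjoint _ h1 (J.mul_mem_left _ he)
  rw [sub_mul, sub_eq_zero, ← Algebra.smul_def] at h0
  exact congrArg Subtype.val h0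

lemma mem_range_mulRight_iff {e x : H} (he : e * e = e) :
    x ∈ LinearMap.range (LinearMap.mulRight 𝕜 e) ↔ x * e = x := by
  refine ⟨?_, fun h ↦ ⟨x, h⟩⟩
  rintro ⟨y, rfl⟩
  simp [mul_assoc, he]

section

variable [CharZero 𝕜] [FiniteDimensional 𝕜 H]

/-- S is bijective on K, so S(e) is a normalized right integral. Evaluating S(e)e from both sides
gives S(e) = e. -/
lemma antipodeSq_eq_self_of_integral {K : Subalgebra 𝕜 H} (hK : IsHopfSubalgebra K) {e : H}
    (heK : e ∈ K) (he : ∀ x ∈ K, x * e = counit (R := 𝕜) x • e) (he1 : counit (R := 𝕜) e = 1) :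
    antipodeSq 𝕜 H e = e := by
  let S : K →ₗ[𝕜] K := (antipode 𝕜).restrict (p := K.toSubmodule) (q := K.toSubmodule)
    hK.antipode_mem
  have hS : Function.Surjective S := LinearMap.injective_iff_surjective.1 fun x y hxy ↦
    Subtype.ext ((antipode_bijective (𝕜 := 𝕜) (H := H)).1 (congrArg Subtype.val hxy))
  have h (z : H) (hz : z ∈ K) :
      antipode 𝕜 e * z = counit (R := 𝕜) z • antipode 𝕜 e := by
    obtain ⟨x, hx⟩ := hS ⟨z, hz⟩
    have hx : antipode 𝕜 (x : H) = z := congrArg Subtype.val hx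
    rw [← hx, ← antipode_mul_antidistrib, he x x.2, map_smul, counit_antipode]
  have h1 : antipode 𝕜 e = e := by
    have h2 := h e heK
    rwa [he _ (hK.antipode_mem e heK), counit_antipode, he1, one_smul, one_smul, eq_comm] at h2
  rw [antipodeSq_apply, h1, h1]

lemma isSemisimpleRing_of_forall_antipodeSq_mul_eq {e : H} (he : e * e = e) (he0 : e ≠ 0)
    (h : ∀ x, antipodeSq 𝕜 H (x * e) = x * e) : IsSemisimpleRing H := by
  apply isSemisimpleRing_of_trace_ne_zero (𝕜 := 𝕜) e
  have hmem (x : H) : (LinearMap.mulRight 𝕜 e ∘ₗ (antipodeSq 𝕜 H).toLinearMap) x ∈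
      LinearMap.range (LinearMap.mulRight 𝕜 e) := ⟨_, rfl⟩
  rw [← LinearMap.trace_restrict_eq_of_forall_mem _ _ hmem]
  have h1 : (LinearMap.mulRight 𝕜 e ∘ₗ (antipodeSq 𝕜 H).toLinearMap).restrict
      (fun x _ ↦ hmem x) = LinearMap.id := by
    ext ⟨x, hx⟩
    obtain ⟨y, rfl⟩ := hx
    simp only [LinearMap.mulRight_apply, LinearMap.coe_restrict_apply, LinearMap.comp_apply,
      AlgHom.toLinearMap_apply, h, LinearMap.id_apply, mul_assoc, he]
  rw [h1, LinearMap.trace_id, Nat.cast_ne_zero]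
  intro h0
  have : (⟨e, ⟨e, he⟩⟩ : LinearMap.range (LinearMap.mulRight 𝕜 e)) = 0 :=
    (Module.finrank_zero_iff.1 h0).elim _ _
  exact he0 (congrArg Subtype.val this)

/-- The operator x ↦ S²(x)e has image in He and restricts there to S², which has l-power order; l ∤
dim He excludes trace zero. -/
lemma isSemisimpleRing_of_antipodeSq_pow_eq_one [IsAlgClosed 𝕜] {l r : ℕ} (hl : l.Prime)
    (hpow : antipodeSq 𝕜 H ^ l ^ r = 1) {e : H} (he : e * e = e) (hSe : antipodeSq 𝕜 H e = e)
    (hdim : ¬ l ∣ Module.finrank 𝕜 (LinearMap.range (LinearMap.mulRight 𝕜 e))) :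
    IsSemisimpleRing H := by
  apply isSemisimpleRing_of_trace_ne_zero (𝕜 := 𝕜) e
  have hmem (x : H) : (LinearMap.mulRight 𝕜 e ∘ₗ (antipodeSq 𝕜 H).toLinearMap) x ∈
      LinearMap.range (LinearMap.mulRight 𝕜 e) := ⟨_, rfl⟩
  rw [← LinearMap.trace_restrict_eq_of_forall_mem _ _ hmem]
  refine fun h0 ↦ hdim (dvd_finrank_of_trace_eq_zero (r := r) hl ?_ h0)
  generalize hG : (LinearMap.mulRight 𝕜 e ∘ₗ (antipodeSq 𝕜 H).toLinearMap).restrict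
    (fun x _ ↦ hmem x) = G
  have hGpow (j : ℕ) (x : LinearMap.range (LinearMap.mulRight 𝕜 e)) :
      ((G ^ j) x : H) = (antipodeSq 𝕜 H ^ j) x := by
    induction j with
    | zero => rfl
    | succ j ih =>
      have h2 := congrArg (antipodeSq 𝕜 H) ((mem_range_mulRight_iff (𝕜 := 𝕜) he).1 ((G ^ j) x).2)
      rw [map_mul, hSe] at h2
      rw [pow_succ', pow_succ', Module.End.mul_apply, AlgHom.mul_apply, ← ih, ← hG,
        LinearMap.coe_restrict_apply, hG]
      exact h2
  ext x
  rw [hGpow, hpow]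
  rfl

end

end HopfAlgebra

/-! ### The case of a translation of order p -/

lemma LinearIndependent.eq_zero_of_forall_apply_eq_zero {𝕜 V ι : Type*} [Field 𝕜] [AddCommGroup V]
    [Module 𝕜 V] [FiniteDimensional 𝕜 V] [Fintype ι] {f : ι → Module.Dual 𝕜 V}
    (hf : LinearIndependent 𝕜 f) (hcard : Fintype.card ι = Module.finrank 𝕜 V) {v : V}
    (hv : ∀ i, f i v = 0) : v = 0 := by
  have hspan := hf.span_eq_top_of_card_eq_finrank' (hcard.trans Subspace.dual_finrank_eq.symm)
  rw [← Module.forall_dual_apply_eq_zero_iff 𝕜]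
  intro g
  have hg : g ∈ Submodule.span 𝕜 (Set.range f) := hspan ▸ Submodule.mem_top
  induction hg using Submodule.span_induction with
  | mem x hx => obtain ⟨i, rfl⟩ := hx; exact hv i
  | zero => rfl
  | add x y _ _ hx hy => simp [hx, hy]
  | smul a x _ hx => simp [hx]

namespace HopfAlgebra

open Coalgebra

variable {𝕜 H : Type*} [Field 𝕜] [Ring H] [HopfAlgebra 𝕜 H]

/-- The left hit action of a character, as an algebra endomorphism. -/
noncomputable def hitLeftAlgHom (α : H →ₐ[𝕜] 𝕜) : H →ₐ[𝕜] H :=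
  ((Algebra.TensorProduct.lid 𝕜 H).toAlgHom.comp
    (Algebra.TensorProduct.map α (.id 𝕜 H))).comp (Bialgebra.comulAlgHom 𝕜 H)

/-- The right hit action of a character, as an algebra endomorphism. -/
noncomputable def hitRightAlgHom (α : H →ₐ[𝕜] 𝕜) : H →ₐ[𝕜] H :=
  ((Algebra.TensorProduct.rid 𝕜 𝕜 H).toAlgHom.comp
    (Algebra.TensorProduct.map (.id 𝕜 H) α)).comp (Bialgebra.comulAlgHom 𝕜 H)

lemma hitLeftAlgHom_apply (α : H →ₐ[𝕜] 𝕜) (x : H) :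
    hitLeftAlgHom α x = hitLeft α.toLinearMap x := rfl

lemma hitRightAlgHom_apply (α : H →ₐ[𝕜] 𝕜) (x : H) :
    hitRightAlgHom α x = hitRight α.toLinearMap x := rfl

/-- Inverses in the convolution algebra are unique: α ∘ S inverts α, and α ∘ S² inverts α ∘ S. -/
lemma character_comp_antipodeSq (α : H →ₐ[𝕜] 𝕜) (x : H) : α (antipodeSq 𝕜 H x) = α x := by
  let β : H →ₗ[𝕜] 𝕜 := α.toLinearMap ∘ₗ antipode 𝕜
  have h1 (x : H) : β (hitLeft α.toLinearMap x) = counit (R := 𝕜) x := by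
    have h := congrArg α (sum_mul_antipode_eq_algebraMap_counit (R := 𝕜) (ℛ 𝕜 x))
    rw [AlgHom.commutes, map_sum] at h
    rw [hitLeft_apply, map_sum]
    simpa [β] using h
  have h2 (x : H) : α (antipodeSq 𝕜 H (hitLeft β x)) = counit (R := 𝕜) x := by
    have h := congrArg (fun y ↦ α (antipode 𝕜 y))
      (sum_mul_antipode_eq_algebraMap_counit (R := 𝕜) (ℛ 𝕜 x))
    simp only [map_sum, antipode_mul_antidistrib, map_mul, Algebra.algebraMap_eq_smul_one,
      map_smul, antipode_one, map_one] at h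
    rw [hitLeft_apply, map_sum, map_sum]
    simpa [β, antipodeSq_apply, mul_comm] using h
  have h3 : hitLeft β ∘ₗ hitLeft α.toLinearMap = LinearMap.id := by
    have hT : comul ∘ₗ (hitLeft β ∘ₗ hitLeft α.toLinearMap) =
        (hitLeft β ∘ₗ hitLeft α.toLinearMap).rTensor H ∘ₗ comul (R := 𝕜) := by
      rw [← LinearMap.comp_assoc, comul_hitLeft, LinearMap.comp_assoc, comul_hitLeft,
        ← LinearMap.comp_assoc, ← LinearMap.rTensor_comp]
    rw [eq_hitLeft_of_comul_comp hT]
    have h4 : counit ∘ₗ hitLeft β ∘ₗ hitLeft α.toLinearMap = counit (R := 𝕜) := by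
      ext y
      rw [LinearMap.comp_apply, LinearMap.comp_apply, counit_hitLeft, h1]
    rw [h4]
    exact LinearMap.ext hitLeft_counit
  have h5 := h2 (hitLeft α.toLinearMap x)
  rw [← LinearMap.comp_apply (hitLeft β), h3, counit_hitLeft] at h5
  exact h5

section

variable [CharZero 𝕜] [IsAlgClosed 𝕜] [FiniteDimensional 𝕜 H] {K : Subalgebra 𝕜 H}

lemma isSemisimpleRing_of_comul_comp (hK : IsHopfSubalgebra K) {p : ℕ} (hp : p.Prime)
    (hpK : ¬ p ∣ Module.finrank 𝕜 K) {e : H} (heK : e ∈ K) (he : e * e = e)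
    (he1 : counit (R := 𝕜) e = 1) (hSe : antipodeSq 𝕜 H e = e)
    (hdim : Module.finrank 𝕜 (LinearMap.range (LinearMap.mulRight 𝕜 e)) = p) {T : H →ₐ[𝕜] H}
    (hT : comul ∘ₗ T.toLinearMap = T.toLinearMap.rTensor H ∘ₗ comul (R := 𝕜))
    (hTp : T ^ p = 1) (hT1 : T ≠ 1) : IsSemisimpleRing H := by
  -- Otherwise T would act nontrivially on K with order p, forcing p ∣ dim K.
  have hTe : T e = e := by
    by_contra h
    exact hpK (hK.dvd_finrank_of_comul_comp hp hT hTp ⟨e, heK, h⟩)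
  have hord : orderOf T = p := by
    have := Fact.mk hp
    exact orderOf_eq_prime hTp hT1
  let χ (j : Fin p) : H →ₐ[𝕜] 𝕜 := (Bialgebra.counitAlgHom 𝕜 H).comp (T ^ (j : ℕ))
  have hχinj : Function.Injective (fun j ↦ (χ j : H →* 𝕜)) := by
    intro i j hij
    have hij' : (counit ∘ₗ (T ^ (i : ℕ)).toLinearMap : H →ₗ[𝕜] 𝕜) =
        counit ∘ₗ (T ^ (j : ℕ)).toLinearMap := LinearMap.ext fun x ↦ DFunLike.congr_fun hij x
    have h : T ^ (i : ℕ) = T ^ (j : ℕ) := by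
      apply AlgHom.toLinearMap_injective
      rw [eq_hitLeft_of_comul_comp (comul_pow_toLinearMap hT i),
        eq_hitLeft_of_comul_comp (comul_pow_toLinearMap hT j), hij']
    exact Fin.ext (pow_injOn_Iio_orderOf (by simp [hord]) (by simp [hord]) h)
  have hχe (j : Fin p) : χ j e = 1 := by
    have (j : ℕ) : (T ^ j) e = e := by
      induction j with
      | zero => rfl
      | succ j ih => rw [pow_succ, AlgHom.mul_apply, hTe, ih]
    change counit (R := 𝕜) ((T ^ (j : ℕ)) e) = 1
    rw [this, he1]
  -- Since χ j e = 1, a relation among the restrictions to He, evaluated at xe, becomes a relation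
  -- among the distinct characters χ j on H. These p functionals therefore span the dual of He.
  let ψ (j : Fin p) : Module.Dual 𝕜 (LinearMap.range (LinearMap.mulRight 𝕜 e)) :=
    (χ j).toLinearMap ∘ₗ Submodule.subtype _
  have hψ : LinearIndependent 𝕜 ψ := by
    have hli := (linearIndependent_monoidHom H 𝕜).comp _ hχinj
    rw [linearIndependent_iff'] at hli ⊢
    refine fun s c hc ↦ hli s c (funext fun x ↦ ?_)
    simpa [ψ, hχe] using LinearMap.congr_fun hc ⟨x * e, ⟨x, rfl⟩⟩
  refine isSemisimpleRing_of_forall_antipodeSq_mul_eq (𝕜 := 𝕜) he ?_ fun x ↦ ?_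
  · rintro rfl
    simp at he1
  have hmem : antipodeSq 𝕜 H (x * e) - x * e ∈ LinearMap.range (LinearMap.mulRight 𝕜 e) :=
    ⟨antipodeSq 𝕜 H x - x, by simp [sub_mul, hSe]⟩
  have h0 := hψ.eq_zero_of_forall_apply_eq_zero (by simp [hdim]) (v := ⟨_, hmem⟩) fun j ↦ by
    change χ j (antipodeSq 𝕜 H (x * e) - x * e) = 0
    rw [map_sub, character_comp_antipodeSq, sub_self]
  exact sub_eq_zero.1 (congrArg Subtype.val h0)

end

end HopfAlgebra

/-! ### The case of a group-like element of order p -/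

/-- Distinct nonzero vectors `v i` on which a linear map `V → V ⊗ V` takes the values
`v i ⊗ v i` are linearly independent. -/
lemma linearIndependent_of_apply_eq_tmul_self {𝕜 V ι : Type*} [Field 𝕜] [AddCommGroup V]
    [Module 𝕜 V] (Ψ : V →ₗ[𝕜] V ⊗[𝕜] V) {v : ι → V} (hΨ : ∀ i, Ψ (v i) = v i ⊗ₜ v i)
    (hv : Function.Injective v) (hv0 : ∀ i, v i ≠ 0) : LinearIndependent 𝕜 v := by
  classical
  rw [linearIndependent_iff']
  intro s a ha i hi
  by_contra hai
  have hmul (b : ι → 𝕜) (hb : ∑ j ∈ s, b j • v j = 0) (f : V →ₗ[𝕜] 𝕜) :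
      ∑ j ∈ s, (f (v j) * b j) • v j = 0 := by
    have h := congrArg (TensorProduct.lid 𝕜 V ∘ f.rTensor V ∘ Ψ) hb
    simp only [Function.comp_apply, map_sum, map_smul, hΨ, LinearMap.rTensor_tmul,
      TensorProduct.lid_tmul, map_zero, smul_smul] at h
    simpa only [mul_comm] using h
  have key (t : Finset ι) (ht : i ∉ t) : ∃ b : ι → 𝕜, ∑ j ∈ s, b j • v j = 0 ∧ b i ≠ 0 ∧
      ∀ j ∈ t, b j = 0 := by
    induction t using Finset.induction_on with
    | empty => exact ⟨a, ha, hai, by simp⟩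
    | insert k t hkt ih =>
      rw [Finset.mem_insert, not_or] at ht
      obtain ⟨b, hb, hbi, hbt⟩ := ih ht.2
      obtain ⟨f, hf⟩ : ∃ f : Module.Dual 𝕜 V, f (v i - v k) ≠ 0 := by
        by_contra! h
        exact ht.1 (hv (sub_eq_zero.1 ((Module.forall_dual_apply_eq_zero_iff 𝕜 _).1 h)))
      refine ⟨fun j ↦ (f (v j) - f (v k)) * b j, ?_, mul_ne_zero (by rwa [← map_sub]) hbi, ?_⟩
      · simp only [sub_mul, sub_smul, Finset.sum_sub_distrib, hmul b hb, mul_smul (f (v k)),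
          ← Finset.smul_sum, hb, smul_zero, sub_zero]
      · intro j hj
        rcases Finset.mem_insert.1 hj with rfl | hj
        · simp
        · simp [hbt j hj]
  obtain ⟨b, hb, hbi, hbt⟩ := key (s.erase i) (Finset.notMem_erase i s)
  rw [← Finset.add_sum_erase s _ hi, Finset.sum_eq_zero (fun j hj ↦ by rw [hbt j hj, zero_smul]),
    add_zero] at hb
  exact (smul_ne_zero hbi (hv0 i)) hb

namespace HopfAlgebra

open Coalgebra

variable {𝕜 H : Type*} [Field 𝕜] [Ring H] [HopfAlgebra 𝕜 H]

lemma comul_mul_tmul_of_integral {K : Subalgebra 𝕜 H} (hK : IsHopfSubalgebra K) {e : H}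
    (heK : e ∈ K) (he : ∀ x ∈ K, x * e = counit (R := 𝕜) x • e) :
    comul (R := 𝕜) e * e ⊗ₜ[𝕜] e = counit (R := 𝕜) e • e ⊗ₜ[𝕜] e := by
  have h1 (t : K ⊗[𝕜] K) : Algebra.TensorProduct.map K.val K.val t * e ⊗ₜ[𝕜] e =
      TensorProduct.lid 𝕜 𝕜 (TensorProduct.map counit counit
        (Algebra.TensorProduct.map K.val K.val t)) • e ⊗ₜ[𝕜] e := by
    induction t with
    | zero => simp
    | add a b ha hb => simp only [map_add, add_mul, add_smul, ha, hb]
    | tmul a b =>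
      simp [he, a.2, b.2, TensorProduct.smul_tmul', TensorProduct.tmul_smul, smul_smul, mul_comm]
  have h2 := h1 (hK.comulAlgHom ⟨e, heK⟩)
  rw [hK.map_comulAlgHom] at h2
  rw [h2, comul_eq_sum, map_sum, map_sum]
  congr 1
  have h3 := congrArg (counit (R := 𝕜)) (sum_counit_smul (R := 𝕜) (ℛ 𝕜 e))
  simpa using h3

section

variable [CharZero 𝕜] [FiniteDimensional 𝕜 H] {K : Subalgebra 𝕜 H}

/-- A nonzero integral l on K has l(e) ≠ 0, since otherwise l(xe) = ε(x)l(e) = 0 for all x, against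
nondegeneracy. Any extension of l / l(e) to H serves as f. -/
lemma exists_hitLeft_eq_one_of_integral (hK : IsHopfSubalgebra K) {e : H}
    (heK : e ∈ K) (he : ∀ x ∈ K, x * e = counit (R := 𝕜) x • e) (he0 : e ≠ 0) :
    ∃ f : H →ₗ[𝕜] 𝕜, hitLeft f e = 1 := by
  let := hK.hopfAlgebra
  obtain ⟨l, hl, hl0⟩ := exists_isCointegral_ne_zero (𝕜 := 𝕜) (H := K)
  have hle : l ⟨e, heK⟩ ≠ 0 := by
    intro h
    refine he0 (congrArg Subtype.val (hl.eq_zero_of_mulRight hl0 (x := ⟨e, heK⟩) ?_))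
    ext x
    have hx : x * (⟨e, heK⟩ : K) = counit (R := 𝕜) (x : H) • (⟨e, heK⟩ : K) :=
      Subtype.ext (he x x.2)
    rw [LinearMap.comp_apply, LinearMap.mulRight_apply, hx, map_smul, h, smul_zero,
      LinearMap.zero_apply]
  obtain ⟨f, hf⟩ := LinearMap.exists_extend (p := K.toSubmodule) l
  have hf (x : K) : f x = l x := LinearMap.congr_fun hf x
  refine ⟨(l ⟨e, heK⟩)⁻¹ • f, ?_⟩
  have h1 (t : K ⊗[𝕜] K) : (TensorProduct.lid 𝕜 H) (((l ⟨e, heK⟩)⁻¹ • f).rTensor H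
      (Algebra.TensorProduct.map K.val K.val t)) =
      (l ⟨e, heK⟩)⁻¹ • ((TensorProduct.lid 𝕜 K (l.rTensor K t) : K) : H) := by
    induction t with
    | zero => simp
    | add a b ha hb => simp only [map_add, ha, hb, Subalgebra.coe_add, smul_add]
    | tmul a b => simp [hf]
  have h2 : TensorProduct.lid 𝕜 K (l.rTensor K (hK.comulAlgHom ⟨e, heK⟩)) =
    l ⟨e, heK⟩ • (1 : K) := hl _
  rw [hitLeft, LinearMap.comp_apply, LinearMap.comp_apply, ← hK.map_comulAlgHom ⟨e, heK⟩]
  refine (h1 _).trans ?_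
  rw [h2, Subalgebra.coe_smul, inv_smul_smul₀ hle, Subalgebra.coe_one]

/-- From ge = e follows Δ(e) = (g ⊗ g)Δ(e). Hitting e with f(S(g)·), where f(e₁)e₂ = 1, gives g, and
K is stable under hits. -/
lemma mem_of_isGroupLikeElem_of_mul_integral (hK : IsHopfSubalgebra K) {e : H}
    (heK : e ∈ K) (he : ∀ x ∈ K, x * e = counit (R := 𝕜) x • e) (he0 : e ≠ 0) {g : H}
    (hg : IsGroupLikeElem 𝕜 g) (hge : g * e = e) : g ∈ K := by
  obtain ⟨f, hf⟩ := exists_hitLeft_eq_one_of_integral hK heK he he0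
  have h1 (t : H ⊗[𝕜] H) : TensorProduct.lid 𝕜 H
      ((f ∘ₗ LinearMap.mulLeft 𝕜 (antipode 𝕜 g)).rTensor H ((g ⊗ₜ g) * t)) =
      g * TensorProduct.lid 𝕜 H (f.rTensor H t) := by
    induction t with
    | zero => simp
    | add a b ha hb => simp only [map_add, mul_add, ha, hb]
    | tmul a b => simp [← mul_assoc, hg.antipode_mul_cancel]
  have h2 := h1 (comul e)
  rw [← hg.comul_eq_tmul_self, ← Bialgebra.comul_mul, hge] at h2
  have h3 : hitLeft (f ∘ₗ LinearMap.mulLeft 𝕜 (antipode 𝕜 g)) e = g * hitLeft f e := h2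
  rw [hf, mul_one] at h3
  exact h3 ▸ hK.hitLeft_mem _ heK

variable [IsAlgClosed 𝕜]

lemma isSemisimpleRing_of_isGroupLikeElem (hK : IsHopfSubalgebra K) {p : ℕ} (hp : p.Prime)
    (hpK : ¬ p ∣ Module.finrank 𝕜 K) {e : H} (heK : e ∈ K)
    (he : ∀ x ∈ K, x * e = counit (R := 𝕜) x • e)
    (he1 : counit (R := 𝕜) e = 1) (hSe : antipodeSq 𝕜 H e = e)
    (hdim : Module.finrank 𝕜 (LinearMap.range (LinearMap.mulRight 𝕜 e)) = p) {g : H}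
    (hg : IsGroupLikeElem 𝕜 g) (hgp : g ^ p = 1) (hg1 : g ≠ 1) : IsSemisimpleRing H := by
  have hee : e * e = e := by rw [he e heK, he1, one_smul]
  have he0 : e ≠ 0 := by
    rintro rfl
    simp at he1
  have hord : orderOf g = p := by
    have := Fact.mk hp
    exact orderOf_eq_prime hgp hg1
  -- If g^m fixed e, it would be a group-like element of K of order p, so p would divide dim K.
  have hgK (m : ℕ) (hm0 : 0 < m) (hmp : m < p) : g ^ m * e ≠ e := by
    intro h
    refine hpK (hK.dvd_finrank_of_isGroupLikeElem hp
      (mem_of_isGroupLikeElem_of_mul_integral hK heK he he0 hg.pow h) hg.pow ?_ ?_)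
    · rw [← pow_mul, mul_comm, pow_mul, hgp, one_pow]
    · exact pow_ne_one_of_lt_orderOf hm0.ne' (hord ▸ hmp)
  have hcancel (i : ℕ) (x y : H) (h : g ^ i * x = g ^ i * y) : x = y :=
    (hg.isUnit.pow i).mul_left_cancel h
  let v (i : Fin p) : LinearMap.range (LinearMap.mulRight 𝕜 e) := ⟨g ^ (i : ℕ) * e, ⟨_, rfl⟩⟩
  have hinj : Function.Injective fun i : Fin p ↦ g ^ (i : ℕ) * e := by
    have hlt (i j : Fin p) (hij : i < j) : g ^ (i : ℕ) * e ≠ g ^ (j : ℕ) * e := by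
      intro h
      rw [← Nat.add_sub_cancel' (Fin.le_def.1 hij.le), pow_add, mul_assoc] at h
      exact hgK (j - i) (Nat.sub_pos_of_lt hij) (by lia) (hcancel _ _ _ h).symm
    intro i j hij
    rcases lt_trichotomy i j with h | h | h
    · exact (hlt i j h hij).elim
    · exact h
    · exact (hlt j i h hij.symm).elim
  have hli : LinearIndependent 𝕜 fun i : Fin p ↦ g ^ (i : ℕ) * e := by
    -- The map x ↦ Δ(x)(e ⊗ e) treats the vectors gⁱe as group-like, because Δ(e)(e ⊗ e) = e ⊗ e.
    refine linearIndependent_of_apply_eq_tmul_self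
      (LinearMap.mulRight 𝕜 (e ⊗ₜ[𝕜] e) ∘ₗ comul) (fun i ↦ ?_) hinj fun i h ↦ ?_
    · rw [LinearMap.comp_apply, LinearMap.mulRight_apply, Bialgebra.comul_mul, mul_assoc,
        comul_mul_tmul_of_integral hK heK he, he1, one_smul, hg.pow.comul_eq_tmul_self,
        Algebra.TensorProduct.tmul_mul_tmul]
    · exact he0 (hcancel i e 0 (by rw [h, mul_zero]))
  have hv : LinearIndependent 𝕜 v := LinearIndependent.of_comp (Submodule.subtype _) hli
  have hspan := hv.span_eq_top_of_card_eq_finrank' (by simp [hdim])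
  have hfix (w : LinearMap.range (LinearMap.mulRight 𝕜 e)) : antipodeSq 𝕜 H (w : H) = w := by
    have hw : w ∈ Submodule.span 𝕜 (Set.range v) := hspan ▸ Submodule.mem_top
    induction hw using Submodule.span_induction with
    | mem x hx =>
      obtain ⟨i, rfl⟩ := hx
      change antipodeSq 𝕜 H (g ^ (i : ℕ) * e) = g ^ (i : ℕ) * e
      rw [map_mul, hSe, antipodeSq_apply, hg.pow.antipode_antipode]
    | zero => simp
    | add x y _ _ hx hy => simp [hx, hy]
    | smul a x _ hx => simp [hx]
  exact isSemisimpleRing_of_forall_antipodeSq_mul_eq (𝕜 := 𝕜) hee he0 fun x ↦ hfix ⟨_, x, rfl⟩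

end

end HopfAlgebra

/-! ### The order of S² from Radford's formula -/

namespace HopfAlgebra

open Coalgebra

variable {𝕜 H : Type*} [Field 𝕜] [Ring H] [HopfAlgebra 𝕜 H]

/-- Left and right hits commute and agree after ε, hence so do their powers; a right hit is
determined by its composite with ε. -/
lemma pow_eq_one_hitRightAlgHom (α : H →ₐ[𝕜] 𝕜) {m : ℕ} (h : hitLeftAlgHom α ^ m = 1) :
    hitRightAlgHom α ^ m = 1 := by
  have hcomm : Commute (hitLeftAlgHom α) (hitRightAlgHom α) :=
    AlgHom.ext fun x ↦ hitLeft_hitRight_comm _ _ x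
  have h1 (x : H) : counit (R := 𝕜) (hitRightAlgHom α x) =
      counit (R := 𝕜) (hitLeftAlgHom α x) := by
    rw [hitRightAlgHom_apply, hitLeftAlgHom_apply, counit_hitRight, counit_hitLeft]
  have h2 (j : ℕ) (x : H) : counit (R := 𝕜) ((hitRightAlgHom α ^ j) x) =
      counit (R := 𝕜) ((hitLeftAlgHom α ^ j) x) := by
    induction j generalizing x with
    | zero => rfl
    | succ j ih =>
      rw [pow_succ, AlgHom.mul_apply, ih, ← AlgHom.mul_apply, (hcomm.pow_left j).eq,
        AlgHom.mul_apply, h1, ← AlgHom.mul_apply, ← pow_succ']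
  have h3 (j : ℕ) : comul ∘ₗ (hitRightAlgHom α ^ j).toLinearMap =
      (hitRightAlgHom α ^ j).toLinearMap.lTensor H ∘ₗ comul (R := 𝕜) := by
    induction j with
    | zero =>
      ext x
      simp [show (1 : H →ₐ[𝕜] H).toLinearMap = LinearMap.id from rfl]
    | succ j ih =>
      have h4 : (hitRightAlgHom α ^ (j + 1)).toLinearMap =
          (hitRightAlgHom α ^ j).toLinearMap ∘ₗ hitRight α.toLinearMap := by
        rw [pow_succ]; rfl
      rw [h4, ← LinearMap.comp_assoc, ih, LinearMap.comp_assoc, comul_hitRight,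
        ← LinearMap.comp_assoc, ← LinearMap.lTensor_comp]
  apply AlgHom.toLinearMap_injective
  rw [eq_hitRight_of_comul_comp (h3 m)]
  have h4 : counit ∘ₗ (hitRightAlgHom α ^ m).toLinearMap = counit (R := 𝕜) := by
    ext x
    rw [LinearMap.comp_apply, AlgHom.toLinearMap_apply, h2, h]
    rfl
  rw [h4]
  exact LinearMap.ext hitRight_counit

/-- Conjugation by a group-like element. -/
noncomputable def groupLikeConj {g : H} (hg : IsGroupLikeElem 𝕜 g) : H →ₐ[𝕜] H :=
  AlgHom.ofLinearMap (LinearMap.mulLeft 𝕜 g ∘ₗ LinearMap.mulRight 𝕜 (antipode 𝕜 g))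
    (by simp [hg.mul_antipode_cancel]) fun x y ↦ by
      simp only [LinearMap.comp_apply, LinearMap.mulLeft_apply, LinearMap.mulRight_apply, mul_assoc]
      rw [← mul_assoc (antipode 𝕜 g) g, hg.antipode_mul_cancel, one_mul]

lemma groupLikeConj_apply {g : H} (hg : IsGroupLikeElem 𝕜 g) (x : H) :
    groupLikeConj hg x = g * x * antipode 𝕜 g := (mul_assoc _ _ _).symm

lemma groupLikeConj_pow_eq_one {g : H} (hg : IsGroupLikeElem 𝕜 g) {m : ℕ} (hm : g ^ m = 1) :
    groupLikeConj hg ^ m = 1 := by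
  have h1 (j : ℕ) (x : H) : (groupLikeConj hg ^ j) x = g ^ j * x * antipode 𝕜 g ^ j := by
    induction j with
    | zero => simp
    | succ j ih =>
      rw [pow_succ', AlgHom.mul_apply, ih, groupLikeConj_apply, pow_succ', pow_succ]
      simp only [mul_assoc]
  have h2 : antipode 𝕜 g ^ m = 1 := by
    have hcomm : Commute (antipode 𝕜 g) g := by
      rw [Commute, SemiconjBy, hg.antipode_mul_cancel, hg.mul_antipode_cancel]
    have h := hcomm.mul_pow m
    rwa [hg.antipode_mul_cancel, one_pow, hm, mul_one, eq_comm] at h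
  ext x
  rw [h1, hm, h2, one_mul, mul_one, AlgHom.one_apply]

lemma commute_groupLikeConj {g : H} (hg : IsGroupLikeElem 𝕜 g) {T : H →ₐ[𝕜] H} {a : 𝕜}
    {b : 𝕜} (hab : a * b = 1) (hTg : T g = a • g) (hTg' : T (antipode 𝕜 g) = b • antipode 𝕜 g) :
    Commute (groupLikeConj hg) T := by
  ext x
  simp only [AlgHom.mul_apply, groupLikeConj_apply, map_mul, hTg, hTg', smul_mul_assoc,
    mul_smul_comm, smul_smul]
  rw [mul_comm, hab, one_smul]

lemma antipodeSq_pow_eq_one {g : H} (hg : IsGroupLikeElem 𝕜 g) {α : H →ₐ[𝕜] 𝕜}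
    (h : ∀ a, antipodeSq 𝕜 H (antipodeSq 𝕜 H (hitRight α.toLinearMap a)) =
      g * hitLeft α.toLinearMap a * antipode 𝕜 g) {m : ℕ} (hm : 0 < m) (hgm : g ^ m = 1)
    (hαm : hitLeftAlgHom α ^ m = 1) : antipodeSq 𝕜 H ^ (2 * m) = 1 := by
  have hRm := pow_eq_one_hitRightAlgHom α hαm
  have hLR : Commute (hitLeftAlgHom α) (hitRightAlgHom α) :=
    AlgHom.ext fun x ↦ hitLeft_hitRight_comm _ _ x
  have hL {c : H} (hc : IsGroupLikeElem 𝕜 c) : hitLeftAlgHom α c = α c • c := by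
    simp [hitLeftAlgHom_apply, hitLeft, hc.comul_eq_tmul_self]
  have hR {c : H} (hc : IsGroupLikeElem 𝕜 c) : hitRightAlgHom α c = α c • c := by
    simp [hitRightAlgHom_apply, hitRight, hc.comul_eq_tmul_self]
  have hα : α g * α (antipode 𝕜 g) = 1 := by
    rw [← map_mul, hg.mul_antipode_cancel, map_one]
  have hAL := commute_groupLikeConj hg hα (hL hg) (hL hg.antipode)
  have hAR := commute_groupLikeConj hg hα (hR hg) (hR hg.antipode)
  have h1 : antipodeSq 𝕜 H ^ 2 * hitRightAlgHom α = groupLikeConj hg * hitLeftAlgHom α := by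
    ext x
    rw [sq, AlgHom.mul_apply, AlgHom.mul_apply, AlgHom.mul_apply, groupLikeConj_apply]
    exact h x
  -- Radford's formula solved for S⁴, the inverse of the right hit being its (m − 1)-st power. The
  -- factors commute, so the m-th power splits.
  have h2 : antipodeSq 𝕜 H ^ 2 =
      groupLikeConj hg * hitLeftAlgHom α * hitRightAlgHom α ^ (m - 1) := by
    rw [← h1, mul_assoc, ← pow_succ', Nat.sub_add_cancel hm, hRm, mul_one]
  rw [pow_mul, h2, ((hAR.mul_left hLR).pow_right _).mul_pow, hAL.mul_pow,
    groupLikeConj_pow_eq_one hg hgm, hαm, ← pow_mul, mul_comm, pow_mul, hRm, one_pow, one_mul,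
    one_mul]

end HopfAlgebra

/-! ### Conclusion: the case distinction on the orders -/

lemma exists_prime_dvd_or_eq_two_pow {m : ℕ} (hm : m ≠ 0) :
    (∃ l, l.Prime ∧ l ≠ 2 ∧ l ∣ m) ∨ ∃ r, m = 2 ^ r := by
  by_cases h : ∃ l, l.Prime ∧ l ≠ 2 ∧ l ∣ m
  · exact .inl h
  · refine .inr ⟨_, Nat.eq_prime_pow_of_unique_prime_dvd hm fun {d} hd hdm ↦ ?_⟩
    by_contra hd2
    exact h ⟨d, hd, hd2, hdm⟩

open HopfAlgebra

theorem mainTheorem4 {𝕜 H : Type*} [Field 𝕜] [IsAlgClosed 𝕜] [CharZero 𝕜]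
    [Ring H] [HopfAlgebra 𝕜 H] (n p : ℕ) (hp : p.Prime) (hp_odd : Odd p)
    (hdim : Module.finrank 𝕜 H = 2 ^ n * p)
    (hK : ∃ K : Subalgebra 𝕜 H, IsHopfSubalgebra K ∧ IsSemisimpleRing K ∧
      Module.finrank 𝕜 K = 2 ^ n) :
    IsSemisimpleRing H := by
  obtain ⟨K, hK, hKss, hKdim⟩ := hK
  -- `finrank` is 0 in infinite dimension, so its positivity yields finiteness.
  have hfin : FiniteDimensional 𝕜 H :=
    Module.finite_of_finrank_pos (hdim ▸ Nat.mul_pos (by positivity) hp.pos)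
  obtain ⟨e, heK, he, he1⟩ := exists_integral_of_isSemisimpleRing K
  have hee : e * e = e := by rw [he e heK, he1, one_smul]
  have hSe := antipodeSq_eq_self_of_integral hK heK he he1
  have hWdim : Module.finrank 𝕜 (LinearMap.range (LinearMap.mulRight 𝕜 e)) = p := by
    have h := finrank_eq_finrank_range_mulRight_mul K hK.comul_mem heK he he1
    rw [hdim, hKdim, mul_comm] at h
    exact (Nat.eq_of_mul_eq_mul_right (by positivity) h).symm
  have hp2 : p ≠ 2 := by
    rintro rfl
    exact absurd hp_odd (by decide)
  have hpK : ¬ p ∣ Module.finrank 𝕜 K := by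
    rw [hKdim]
    exact fun h ↦ hp2 ((Nat.prime_dvd_prime_iff_eq hp Nat.prime_two).1 (hp.dvd_of_dvd_pow h))
  have hl {l : ℕ} (hl : l.Prime) (hl2 : l ≠ 2) (h : l ∣ Module.finrank 𝕜 H) : l = p := by
    rw [hdim, hl.dvd_mul] at h
    refine h.elim (fun h ↦ ?_) fun h ↦ (Nat.prime_dvd_prime_iff_eq hl hp).1 h
    exact (hl2 ((Nat.prime_dvd_prime_iff_eq hl Nat.prime_two).1 (hl.dvd_of_dvd_pow h))).elim
  obtain ⟨g, α, hg, hα, hS4⟩ := exists_antipodeSq_antipodeSq_eq (𝕜 := 𝕜) (H := H)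
  have hT : Coalgebra.comul ∘ₗ (hitLeftAlgHom α).toLinearMap =
      (hitLeftAlgHom α).toLinearMap.rTensor H ∘ₗ Coalgebra.comul (R := 𝕜) :=
    comul_hitLeft α.toLinearMap
  have hgord : orderOf g ≠ 0 := by
    obtain ⟨m, hm, h⟩ := exists_pow_eq_one_of_isGroupLikeElem hg
    exact (orderOf_pos_iff.2 (isOfFinOrder_iff_pow_eq_one.2 ⟨m, hm, h⟩)).ne'
  have hTord : orderOf (hitLeftAlgHom α) ≠ 0 := by
    obtain ⟨m, hm, h⟩ := exists_pow_eq_one_of_comul_comp hT hα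
    exact (orderOf_pos_iff.2 (isOfFinOrder_iff_pow_eq_one.2 ⟨m, hm, h⟩)).ne'
  obtain ⟨l, hlp, hl2, k, hk⟩ | ⟨r, hr⟩ := exists_prime_dvd_or_eq_two_pow hgord
  · have hk0 : k ≠ 0 := by
      rintro rfl
      exact hgord hk
    have hpow : (g ^ k) ^ l = 1 := by rw [← pow_mul, mul_comm, ← hk, pow_orderOf_eq_one]
    have hne : g ^ k ≠ 1 := pow_ne_one_of_lt_orderOf hk0
      (hk ▸ lt_mul_of_one_lt_left (Nat.pos_of_ne_zero hk0) hlp.one_lt)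
    obtain rfl := hl hlp hl2 (dvd_finrank_of_isGroupLikeElem (𝕜 := 𝕜) hlp hg.pow hpow hne)
    exact isSemisimpleRing_of_isGroupLikeElem hK hp hpK heK he he1 hSe hWdim hg.pow hpow hne
  obtain ⟨l, hlp, hl2, k, hk⟩ | ⟨s, hs⟩ := exists_prime_dvd_or_eq_two_pow hTord
  · have hk0 : k ≠ 0 := by
      rintro rfl
      exact hTord hk
    have hpow : (hitLeftAlgHom α ^ k) ^ l = 1 := by
      rw [← pow_mul, mul_comm, ← hk, pow_orderOf_eq_one]
    have hne : hitLeftAlgHom α ^ k ≠ 1 := pow_ne_one_of_lt_orderOf hk0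
      (hk ▸ lt_mul_of_one_lt_left (Nat.pos_of_ne_zero hk0) hlp.one_lt)
    have hTk := comul_pow_toLinearMap hT k
    obtain rfl := hl hlp hl2 (dvd_finrank_of_comul_comp hlp hTk hpow hne)
    exact isSemisimpleRing_of_comul_comp hK hp hpK heK hee he1 hSe hWdim hTk hpow hne
  -- Both orders are now powers of 2, with common exponent 2^(r+s), so S² has order dividing
  -- 2^(r+s+1).
  have hgm : g ^ 2 ^ (r + s) = 1 :=
    orderOf_dvd_iff_pow_eq_one.1 (hr ▸ pow_dvd_pow 2 (Nat.le_add_right r s))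
  have hTm : hitLeftAlgHom α ^ 2 ^ (r + s) = 1 :=
    orderOf_dvd_iff_pow_eq_one.1 (hs ▸ pow_dvd_pow 2 (Nat.le_add_left s r))
  have hpow := antipodeSq_pow_eq_one hg hS4 (by positivity) hgm hTm
  rw [← pow_succ'] at hpow
  refine isSemisimpleRing_of_antipodeSq_pow_eq_one Nat.prime_two hpow hee hSe ?_
  rw [hWdim, Nat.prime_dvd_prime_iff_eq Nat.prime_two hp]
  exact hp2.symm
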